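/- **Weighted tree augmentation in the CONGEST model.** An instance of weighted TAP consists of a finite simple undirected 2-edge-connected graph $G=(V,E)$ on $n$ vertices (it remains connected after the removal of any single edge), a spanning tree $T$ of $G$ rooted at a vertex $r$, whose height (the maximum distance in $T$ from $r$) is $h$, non-negative integer edge weights $w(e)$, and pairwise distinct numerical vertex identifiers. An *augmentation* is a set $S\subseteq E$ such that $T\cup S$ is 2-edge-connected; its weight is $w(S)=\sum_{e\in S}w(e)$. The vertices run the same deterministic program in synchronous rounds; in each round every vertex may send one message (a bit string) through each of its incident edges, and local computation is free. Each vertex addresses its incident edges by arbitrary local port numbers and initially knows only its own identifier and, for each incident edge, its weight, whether it belongs to $T$, and whether it leads to the parent of the vertex in $T$. At the end each vertex halts and outputs which of its incident edges are chosen. **Theorem.** There is a deterministic distributed algorithm and a constant $K$ such that for every $c\in\mathbb{N}$ there is a constant $C$ with the following property. On every instance in which all identifiers and all edge weights are at most $n^c$ (so that they have $O(\log n)$ bits), 1. every message sent has at most $C\lfloor\log_2 n\rfloor$ bits; 2. all vertices halt within $K\cdot h$ rounds; 3. the outputs are consistent, that is, the two endpoints of every edge agree on whether it is chosen, and the set $Aug$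 of chosen edges is an augmentation; 4. $w(Aug)\le 2\,w(S)$ for every augmentation $S$. That is, weighted TAP has a deterministic 2-approximation algorithm in the CONGEST model that runs in $O(h)$ rounds. -/

import Mathlib

namespace Congest

/-! ## Deterministic synchronous message passing -/

/-- A network on the vertex set `V`: a simple graph, distinct numerical identifiers, and for every
vertex a numbering `0, 1, 2, …` of its incident edges by ports.  Port `p` of `v` leads to the
`p`-th entry of the list `nbrs v`.  The port numbering is arbitrary. -/
structure Network (V : Type) where
  graph : SimpleGraph V
  ident : V → ℕ
  ident_injective : Function.Injective ident
  nbrs : V → List V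
  nodup_nbrs : ∀ v, (nbrs v).Nodup
  mem_nbrs : ∀ v u, u ∈ nbrs v ↔ graph.Adj v u

/-- A deterministic distributed algorithm with local inputs in `I` and local outputs in `O`: the
program that every vertex runs.  It does not mention the network, so a vertex can depend on the
network only through its local input and the messages that it receives.  Messages are bit strings,
and `none` means that no message is sent (or received) through the given port.  A vertex has halted
as soon as `output` of its state is not `none`. -/
structure Algorithm (I O : Type) where
  State : Type
  init : I → State
  send : State → ℕ → Option (List Bool)
  receive : State → (ℕ → Option (List Bool)) → State
  output : State → Option O

namespace Algorithm

variable {V : Type} [DecidableEq V] {I O : Type}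

/-- What a vertex in state `s` sends through port `p`; a halted vertex is silent. -/
def outgoing (A : Algorithm I O) (s : A.State) (p : ℕ) : Option (List Bool) :=
  if (A.output s).isSome then none else A.send s p

/-- What `v` receives through its ports in one round if the vertices are in the states `σ`:
if port `p` of `v` leads to `u`, it receives there what `u` sends through the port leading to `v`.
Nothing is received through numbers that are not ports of `v`. -/
def inbox (A : Algorithm I O) (N : Network V) (σ : V → A.State) (v : V) :
    ℕ → Option (List Bool) :=
  fun p => (N.nbrs v)[p]?.bind fun u => A.outgoing (σ u) ((N.nbrs u).idxOf v)

/-- The states of all vertices after `t` rounds; a halted vertex keeps its state for ever. -/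
def run (A : Algorithm I O) (N : Network V) (inp : V → I) : ℕ → V → A.State
  | 0 => fun v => A.init (inp v)
  | t + 1 => fun v =>
      let σ := run A N inp t
      if (A.output (σ v)).isSome then σ v else A.receive (σ v) (A.inbox N σ v)

/-- Every message sent through an edge in any round of the execution has at most `B` bits. -/
def MessagesBoundedBy (A : Algorithm I O) (N : Network V) (inp : V → I) (B : ℕ) : Prop :=
  ∀ (t : ℕ) (v : V) (p : ℕ) (m : List Bool), p < (N.nbrs v).length →
    A.outgoing (A.run N inp t v) p = some m → m.length ≤ B

/-- After `R` rounds every vertex has halted, and `out v` is the output of the vertex `v`. -/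
def HaltsWithin (A : Algorithm I O) (N : Network V) (inp : V → I) (R : ℕ) (out : V → O) : Prop :=
  ∀ v, A.output (A.run N inp R v) = some (out v)

end Algorithm

/-! ## The weighted tree augmentation problem -/

/-- An instance of weighted TAP: a network with a 2-edge-connected graph `G`, a rooted spanning
tree of `G`, and non-negative integer weights on the edges. -/
structure TAPInstance (V : Type) extends Network V where
  graph_isEdgeConnected_two : graph.IsEdgeConnected 2
  tree : SimpleGraph V
  tree_le : tree ≤ graph
  tree_isTree : tree.IsTree
  root : V
  weight : Sym2 V → ℕ

/-- What a vertex initially knows about an incident edge. -/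
structure PortInput where
  weight : ℕ
  inTree : Bool
  toParent : Bool

/-- What a vertex initially knows: its own identifier, and the data of its incident edges in the
order of the ports. -/
structure VertexInput where
  ident : ℕ
  ports : List PortInput

namespace TAPInstance

variable {V : Type}

/-- `u` is the parent of `v` in the rooted tree. -/
def IsParent (X : TAPInstance V) (u v : V) : Prop :=
  X.tree.Adj v u ∧ X.tree.dist X.root v = X.tree.dist X.root u + 1

/-- The height of the rooted tree. -/
noncomputable def height [Fintype V] (X : TAPInstance V) : ℕ :=
  Finset.univ.sup fun v => X.tree.dist X.root v

open Classical in
/-- The local input of `v`. -/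
noncomputable def input (X : TAPInstance V) (v : V) : VertexInput where
  ident := X.ident v
  ports := (X.nbrs v).map fun u =>
    { weight := X.weight s(v, u)
      inTree := decide (X.tree.Adj v u)
      toParent := decide (X.IsParent u v) }

/-- `S` is a set of edges of the graph whose addition makes the tree 2-edge-connected. -/
def IsAugmentation (X : TAPInstance V) (S : Finset (Sym2 V)) : Prop :=
  (S : Set (Sym2 V)) ⊆ X.graph.edgeSet ∧
    (X.tree ⊔ SimpleGraph.fromEdgeSet (S : Set (Sym2 V))).IsEdgeConnected 2

/-- The total weight of a set of edges. -/
def cost (X : TAPInstance V) (S : Finset (Sym2 V)) : ℕ :=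
  ∑ e ∈ S, X.weight e

/-- The sets of ports `out v` describe the edge set `S` locally: for every vertex `v`, the edge at a
port of `v` belongs to `S` exactly if that port belongs to `out v`. -/
def LocallyDescribes (X : TAPInstance V) (out : V → Finset ℕ) (S : Finset (Sym2 V)) : Prop :=
  ∀ (v u : V) (p : ℕ), (X.nbrs v)[p]? = some u → (p ∈ out v ↔ s(v, u) ∈ S)

end TAPInstance

end Congest

/-! Orient every non-tree edge in both ways, and let the arc from `x` to `u` cover only the tree
edges between `x` and the lowest common ancestor of `x` and `u`. A set of edges of the graph is an
augmentation exactly if its arcs cover every tree edge (`exists_crossing`,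
`isAugmentation_of_crossing`). Since an edge yields at most two arcs, a cheapest cover by arcs costs
at most twice any augmentation; this is the only loss.

Arcs cover vertical paths, and for these a primal-dual scheme is exact. From the leaves upwards, the
edge above `v` gets as dual value `y v` the least reduced weight of an arc that starts in the
subtree of `v` and leaves it, where reducing subtracts the dual values already assigned along the
path. Keeping this minimum for every ancestor depth `k` gives the table `M v k`. The duals are
feasible (`sum_y_crossed_le`), so their sum is at most the cost of any cover (`sum_y_le`). From the
root downwards, the tree edges split into chains: an edge that does not continue its parent's chain
opens a new one, which follows the minimizing entries down to an arc. These arcs cover everything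
(`exists_chosen_crossing`), and the weight of each telescopes to the sum of the duals on its chain,
so the cover costs exactly the dual value (`sum_chosen`).

In the network, `2h` rounds stream the ancestors' identifiers to all neighbors and spread the
height, `2h` rounds pipeline the table upwards, `h` rounds send the chains downwards, and one round
reports the chosen links to their other endpoints. `table` shows that the numbers computed in this
way form a `CoverTable`. -/

/-! ### Rooted trees and ancestors. -/

/-- A rooted tree on `V`, given by the parent map and the depth function. -/
structure ParentTree (V : Type) where
  root : V
  par : V → V
  dep : V → ℕ
  par_root : par root = root
  dep_root : dep root = 0
  dep_eq : ∀ v, v ≠ root → dep v = dep (par v) + 1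

namespace ParentTree

variable {V : Type} (P : ParentTree V)

/-- `a` is an ancestor of `x`, possibly `x` itself. -/
def Anc (a x : V) : Prop := ∃ i, P.par^[i] x = a

/-- The ancestor of `v` at depth `k`. -/
def up (v : V) (k : ℕ) : V := P.par^[P.dep v - k] v

theorem Anc.refl (x : V) : P.Anc x x := ⟨0, rfl⟩

variable {P}

theorem Anc.trans {a b x : V} (h : P.Anc a b) (h' : P.Anc b x) : P.Anc a x := by
  obtain ⟨i, rfl⟩ := h
  obtain ⟨j, rfl⟩ := h'
  exact ⟨i + j, by rw [Function.iterate_add_apply]⟩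

theorem Anc.par_left {a x : V} (h : P.Anc a x) : P.Anc (P.par a) x := by
  obtain ⟨i, rfl⟩ := h
  exact ⟨i + 1, by rw [Function.iterate_succ_apply']⟩

theorem Anc.of_par {a x : V} (h : P.Anc a (P.par x)) : P.Anc a x := by
  obtain ⟨i, rfl⟩ := h
  exact ⟨i + 1, by rw [Function.iterate_succ_apply]⟩

theorem Anc.eq_or {a x : V} (h : P.Anc a x) : a = x ∨ P.Anc a (P.par x) := by
  obtain ⟨i, rfl⟩ := h
  cases i with
  | zero => exact Or.inl rfl
  | succ i => exact Or.inr ⟨i, by rw [Function.iterate_succ_apply]⟩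

variable (P)

theorem dep_par (v : V) : P.dep (P.par v) = P.dep v - 1 := by
  by_cases h : v = P.root
  · subst h; rw [P.par_root, P.dep_root]
  · rw [P.dep_eq v h]; rfl

theorem dep_pos {v : V} (h : v ≠ P.root) : 0 < P.dep v := by
  rw [P.dep_eq v h]; omega

theorem eq_root_iff {v : V} : v = P.root ↔ P.dep v = 0 :=
  ⟨fun h => h ▸ P.dep_root, fun h => by
    by_contra h'
    have := P.dep_pos h'
    omega⟩

theorem dep_iterate (v : V) (i : ℕ) : P.dep (P.par^[i] v) = P.dep v - i := by
  induction i with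
  | zero => rfl
  | succ i ih => rw [Function.iterate_succ_apply', dep_par, ih]; omega

theorem iterate_eq_root {v : V} {i : ℕ} (h : P.dep v ≤ i) : P.par^[i] v = P.root := by
  rw [P.eq_root_iff, dep_iterate]; omega

theorem root_anc (x : V) : P.Anc P.root x := ⟨P.dep x, P.iterate_eq_root le_rfl⟩

theorem up_anc (v : V) (k : ℕ) : P.Anc (P.up v k) v := ⟨_, rfl⟩

theorem up_self (v : V) : P.up v (P.dep v) = v := by simp [up]

theorem up_par {c : V} {k : ℕ} (hc : c ≠ P.root) (hk : k ≤ P.dep (P.par c)) :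
    P.up c k = P.up (P.par c) k := by
  unfold up
  rw [P.dep_eq c hc, show P.dep (P.par c) + 1 - k = (P.dep (P.par c) - k) + 1 by omega,
    Function.iterate_succ_apply]

theorem up_anc_up (v : V) {k k' : ℕ} (h : k ≤ k') : P.Anc (P.up v k) (P.up v k') :=
  ⟨(P.dep v - k) - (P.dep v - k'), by
    unfold up
    rw [← Function.iterate_add_apply]
    congr 1
    omega⟩

variable {P}

theorem Anc.dep_le {a x : V} (h : P.Anc a x) : P.dep a ≤ P.dep x := by
  obtain ⟨i, rfl⟩ := h
  rw [dep_iterate]; omega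

theorem Anc.eq_up {a x : V} (h : P.Anc a x) : P.up x (P.dep a) = a := by
  obtain ⟨i, rfl⟩ := h
  unfold up
  rw [dep_iterate]
  rcases le_total i (P.dep x) with hi | hi
  · congr 1; omega
  · rw [P.iterate_eq_root hi, P.iterate_eq_root (by omega)]

theorem Anc.induction_up {a : V} {p : V → Prop} (base : ∀ x, P.Anc a x → ∀ _ : p x, x ≠ a →
    p (P.par x)) {x : V} (h : P.Anc a x) (hx : p x) : p a := by
  obtain ⟨i, hi⟩ := h
  induction i generalizing x with
  | zero => exact hi ▸ hx
  | succ i ih =>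
    by_cases hxa : x = a
    · exact hxa ▸ hx
    · exact ih (base x ⟨_, hi⟩ hx hxa) (by rwa [Function.iterate_succ_apply] at hi)

/-- Induction from the leaves to the root. -/
theorem leaf_induction [Finite V] {p : V → Prop}
    (h : ∀ v, (∀ c, c ≠ P.root → P.par c = v → p c) → p v) (v : V) : p v := by
  cases nonempty_fintype V
  have key : ∀ n v, (Finset.univ.sup P.dep) - P.dep v = n → p v := by
    intro n
    induction n using Nat.strong_induction_on with
    | _ n ih =>
      intro v hv
      refine h v fun c hc hcv => ih _ ?_ c rfl
      have h1 := P.dep_eq c hc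
      have h2 : P.dep c ≤ Finset.univ.sup P.dep := Finset.le_sup (Finset.mem_univ c)
      rw [hcv] at h1
      omega
  exact key _ v rfl

end ParentTree

/-! ### Exact covering by vertical arcs: duality and telescoping. -/

/-- A solution of the covering dynamic program on a rooted tree with non-tree links `NT` of weights
`w`.  The entry `M v k` is the least reduced weight of a link that leaves the subtree of the
ancestor of `v` at depth `k` and starts in the subtree of `v`, and it is attained through `src v k`.
The vertex `v` is covered by the link found by following `src · (kk v)` downwards from `v`. -/
structure CoverTable {V : Type} (P : ParentTree V) (NT : V → V → Prop) (w : V → V → ℕ) where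
  M : V → ℕ → ℕ∞
  src : V → ℕ → V
  kk : V → ℕ
  le_own : ∀ {v u k}, 1 ≤ k → k ≤ P.dep v → NT v u → ¬ P.Anc (P.up v k) u → M v k ≤ w v u
  le_child : ∀ {c k}, c ≠ P.root → 1 ≤ k → k ≤ P.dep (P.par c) →
    M (P.par c) k ≤ M c k - M c (P.dep c)
  attained : ∀ {v k}, 1 ≤ k → k ≤ P.dep v → M v k ≠ ⊤ →
    (NT v (src v k) ∧ ¬ P.Anc (P.up v k) (src v k) ∧ M v k = w v (src v k)) ∨
    (src v k ≠ P.root ∧ P.par (src v k) = v ∧ ¬ NT v (src v k) ∧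
      M v k = M (src v k) k - M (src v k) (P.dep (src v k)))
  kk_eq : ∀ {v}, v ≠ P.root →
    (P.par v ≠ P.root ∧ src (P.par v) (kk (P.par v)) = v ∧ kk v = kk (P.par v)) ∨
    (¬ (P.par v ≠ P.root ∧ src (P.par v) (kk (P.par v)) = v) ∧ kk v = P.dep v)

namespace CoverTable

open ParentTree

variable {V : Type} {P : ParentTree V} {NT : V → V → Prop} {w : V → V → ℕ}
  (X : CoverTable P NT w)

/-- The bound holds at `x`, and passing to a parent only subtracts, so it persists on the way up to
`a`. -/
theorem le_link {x u a : V} (hx : NT x u) (hau : ¬ P.Anc a u) (ha : a ≠ P.root) {v : V}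
    (hav : P.Anc a v) (hvx : P.Anc v x) : X.M v (P.dep a) ≤ w x u := by
  have hd := P.dep_pos ha
  refine Anc.induction_up (p := fun z => P.Anc a z → X.M z (P.dep a) ≤ w x u) ?_ hvx ?_ hav
  · intro z hvz hz hne haz
    have hz' := Anc.eq_or hvz |>.resolve_left (Ne.symm hne)
    have hzr : z ≠ P.root := by
      rintro rfl
      have := hvz.dep_le
      rw [P.dep_root] at this
      exact hne (P.eq_root_iff.2 (by omega)).symm
    refine (X.le_child hzr hd haz.dep_le).trans (tsub_le_self.trans (hz haz.of_par))
  · intro hax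
    exact X.le_own hd hax.dep_le hx (by rwa [hax.eq_up])

variable (hcross : ∀ v, v ≠ P.root → ∃ x u, NT x u ∧ P.Anc v x ∧ ¬ P.Anc v u)

include hcross in
theorem ne_top {v : V} (hv : v ≠ P.root) : X.M v (P.dep v) ≠ ⊤ := by
  obtain ⟨x, u, hxu, hx, hu⟩ := hcross v hv
  exact ((X.le_link hxu hu hv (Anc.refl P v) hx).trans_lt (ENat.natCast_lt_top _)).ne

/-- The dual variable of the tree edge above `v`. -/
def y (v : V) : ℕ := (X.M v (P.dep v)).toNat

include hcross in
theorem coe_y {v : V} (hv : v ≠ P.root) : (X.y v : ℕ∞) = X.M v (P.dep v) :=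
  ENat.natCast_toNat (X.ne_top hcross hv)

variable [Fintype V]

/-- An arc that leaves the subtree of a higher ancestor also leaves that of a lower one, and entries
inherited from one child lose the same dual value. This is what makes the truncated subtraction in
the recursion exact. -/
theorem mono (v : V) : ∀ {k k' : ℕ}, 1 ≤ k → k ≤ k' → k' ≤ P.dep v → X.M v k' ≤ X.M v k := by
  induction v using P.leaf_induction with
  | h v ih =>
    intro k k' hk hkk hk'
    by_cases htop : X.M v k = ⊤
    · rw [htop]; exact le_top
    rcases X.attained hk (hkk.trans hk') htop with ⟨h1, h2, h3⟩ | ⟨h1, h2, -, h3⟩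
    · rw [h3]
      exact X.le_own (hk.trans hkk) hk' h1 fun h => h2 ((P.up_anc_up v hkk).trans h)
    · rw [h3]
      have h4 := X.le_child h1 (hk.trans hkk) (h2.symm ▸ hk')
      rw [h2] at h4
      refine h4.trans (tsub_le_tsub_right (ih _ h1 h2 hk hkk ?_) _)
      have := P.dep_eq _ h1
      rw [h2] at this
      omega

theorem M_le_of_weight_le {B : ℕ} (hB : ∀ v u, NT v u → w v u ≤ B) (v : V) :
    ∀ {k : ℕ}, 1 ≤ k → k ≤ P.dep v → X.M v k ≠ ⊤ → X.M v k ≤ B := by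
  induction v using P.leaf_induction with
  | h v ih =>
    intro k hk hk' htop
    rcases X.attained hk hk' htop with ⟨h1, -, h3⟩ | ⟨h1, h2, -, h3⟩
    · rw [h3]
      exact_mod_cast hB _ _ h1
    · have hd := P.dep_eq _ h1
      rw [h2] at hd
      rw [h3] at htop ⊢
      by_cases hc : X.M (X.src v k) k = ⊤
      · have h4 : X.M (X.src v k) (P.dep (X.src v k)) = ⊤ := by
          by_contra h5
          exact htop (by rw [hc]; exact ENat.sub_eq_top_iff.2 ⟨rfl, h5⟩)
        -- Subtracting `⊤` gives `0`, so even this degenerate entry obeys the bound.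
        rw [h4]
        simp
      · exact tsub_le_self.trans (ih _ h1 h2 hk (by omega) hc)

include hcross in
-- A step from `c` to its parent moves `y c` from the table entry into the sum, so the left side
-- never grows.
theorem add_sum_y_le {x u : V} (hx : NT x u) (i : ℕ) {k : ℕ} (hk : 1 ≤ k)
    (hki : k ≤ P.dep (P.par^[i] x)) (hu : ¬ P.Anc (P.up (P.par^[i] x) k) u) :
    X.M (P.par^[i] x) k + ∑ j ∈ Finset.range i, (X.y (P.par^[j] x) : ℕ∞) ≤ w x u := by
  induction i generalizing k with
  | zero => simpa using X.le_own hk hki hx hu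
  | succ i ih =>
    rw [Function.iterate_succ_apply'] at hki hu ⊢
    set c := P.par^[i] x with hc
    have hcr : c ≠ P.root := by
      intro h
      rw [h, P.par_root, P.dep_root] at hki
      omega
    have hd := P.dep_eq c hcr
    rw [← P.up_par hcr hki] at hu
    have h1 := X.le_child hcr hk hki
    have h2 := ih hk (by omega) hu
    have h3 := X.mono c hk (show k ≤ P.dep c by omega) le_rfl
    rw [Finset.sum_range_succ, ← hc, X.coe_y hcross hcr]
    calc X.M (P.par c) k + (∑ j ∈ Finset.range i, (X.y (P.par^[j] x) : ℕ∞) + X.M c (P.dep c))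
        ≤ (X.M c k - X.M c (P.dep c)) +
          (∑ j ∈ Finset.range i, (X.y (P.par^[j] x) : ℕ∞) + X.M c (P.dep c)) := by gcongr
      _ = (X.M c k - X.M c (P.dep c) + X.M c (P.dep c)) +
          ∑ j ∈ Finset.range i, (X.y (P.par^[j] x) : ℕ∞) := by ring
      _ = X.M c k + ∑ j ∈ Finset.range i, (X.y (P.par^[j] x) : ℕ∞) := by
          rw [tsub_add_cancel_of_le h3]
      _ ≤ w x u := h2

open Classical in
include hcross in
-- Dual feasibility. With `i` the number of steps from `x` to the first ancestor shared with `u`,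
-- only the edges above the first `i` vertices can be crossed; the topmost of these contributes its
-- dual value as a table entry, the others through the sum in `add_sum_y_le`.
theorem sum_y_crossed_le {x u : V} (hx : NT x u) :
    ∑ v with (v ≠ P.root ∧ P.Anc v x ∧ ¬ P.Anc v u), X.y v ≤ w x u := by
  have hex : ∃ i, P.Anc (P.par^[i] x) u := ⟨P.dep x, by
    rw [P.iterate_eq_root le_rfl]; exact P.root_anc u⟩
  obtain ⟨i, hi, hmin⟩ : ∃ i, P.Anc (P.par^[i] x) u ∧ ∀ j < i, ¬ P.Anc (P.par^[j] x) u :=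
    ⟨Nat.find hex, Nat.find_spec hex, fun j hj => Nat.find_min hex hj⟩
  have hsub : (Finset.univ.filter fun v => v ≠ P.root ∧ P.Anc v x ∧ ¬ P.Anc v u) ⊆
      (Finset.range i).image fun j => P.par^[j] x := by
    intro v hv
    obtain ⟨-, ⟨j, rfl⟩, h2⟩ := by simpa using hv
    refine Finset.mem_image.2 ⟨j, Finset.mem_range.2 ?_, rfl⟩
    by_contra hj
    refine h2 (Anc.trans ⟨j - i, ?_⟩ hi)
    rw [← Function.iterate_add_apply]
    congr 1
    omega
  have h1 : ∑ v with (v ≠ P.root ∧ P.Anc v x ∧ ¬ P.Anc v u), X.y v ≤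
      ∑ j ∈ Finset.range i, X.y (P.par^[j] x) :=
    (Finset.sum_le_sum_of_subset hsub).trans (Finset.sum_image_le_of_nonneg (by simp))
  refine h1.trans ?_
  cases i with
  | zero => simp
  | succ i =>
    have hu := hmin i (Nat.lt_succ_self i)
    have hr : P.par^[i] x ≠ P.root := fun h => hu (h ▸ P.root_anc u)
    have h2 := X.add_sum_y_le hcross hx i (P.dep_pos hr) le_rfl (by rwa [P.up_self])
    rw [← X.coe_y hcross hr, add_comm] at h2
    rw [Finset.sum_range_succ]
    exact_mod_cast h2

open Classical in
include hcross in
/-- Weak duality. -/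
theorem sum_y_le (D : Finset (V × V)) (hD : ∀ d ∈ D, NT d.1 d.2)
    (hcov : ∀ v, v ≠ P.root → ∃ d ∈ D, P.Anc v d.1 ∧ ¬ P.Anc v d.2) :
    ∑ v with v ≠ P.root, X.y v ≤ ∑ d ∈ D, w d.1 d.2 := by
  calc ∑ v with v ≠ P.root, X.y v
      ≤ ∑ v with v ≠ P.root, ∑ d ∈ D, if P.Anc v d.1 ∧ ¬ P.Anc v d.2 then X.y v else 0 := by
        refine Finset.sum_le_sum fun v hv => ?_
        obtain ⟨d, hd, hvd⟩ := hcov v (by simpa using hv)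
        refine le_trans ?_ (Finset.single_le_sum (fun _ _ => Nat.zero_le _) hd)
        rw [if_pos hvd]
    _ = ∑ d ∈ D, ∑ v with v ≠ P.root, if P.Anc v d.1 ∧ ¬ P.Anc v d.2 then X.y v else 0 :=
        Finset.sum_comm
    _ ≤ ∑ d ∈ D, w d.1 d.2 := by
        refine Finset.sum_le_sum fun d hd => ?_
        rw [← Finset.sum_filter, Finset.filter_filter]
        exact X.sum_y_crossed_le hcross (hD d hd)

include hcross in
-- At the top of a chain this is `ne_top`. Further down `kk` is unchanged while the depth grows, and
-- an infinite entry at the child would make the finite entry at the parent infinite.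
theorem kk_spec (v : V) (hv : v ≠ P.root) :
    1 ≤ X.kk v ∧ X.kk v ≤ P.dep v ∧ X.M v (X.kk v) ≠ ⊤ := by
  have key : ∀ n v, P.dep v = n → v ≠ P.root →
      1 ≤ X.kk v ∧ X.kk v ≤ P.dep v ∧ X.M v (X.kk v) ≠ ⊤ := by
    intro n
    induction n with
    | zero => intro v h hv; exact absurd (P.eq_root_iff.2 h) hv
    | succ n ih =>
      intro v h hv
      rcases X.kk_eq hv with ⟨h1, h2, h3⟩ | ⟨-, h3⟩
      · have hd := P.dep_eq v hv
        obtain ⟨i1, i2, i3⟩ := ih (P.par v) (by omega) h1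
        rw [h3]
        refine ⟨i1, by omega, ?_⟩
        rcases X.attained i1 i2 i3 with ⟨-, -, h4⟩ | ⟨-, -, -, h4⟩
        · intro htop
          have h5 := X.coe_y hcross hv
          have h6 := X.mono v i1 (show X.kk (P.par v) ≤ P.dep v by omega) le_rfl
          have h7 := X.attained i1 i2 i3
          rw [h2] at h7
          rcases h7 with ⟨-, h8, -⟩ | ⟨-, -, -, h8⟩
          -- The source `v` is a child of `P.par v`, so it cannot be the far end of an arc leaving a
          -- subtree that contains it.
          · exact h8 (((P.up_anc _ _).of_par))
          · rw [htop, ← h5, ENat.top_sub_natCast] at h8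
            exact i3 h8
        · rw [h2] at h4
          intro htop
          rw [htop, ← X.coe_y hcross hv, ENat.top_sub_natCast] at h4
          exact i3 h4
      · rw [h3]
        exact ⟨P.dep_pos hv, le_rfl, X.ne_top hcross hv⟩
  exact key _ v rfl hv

include hcross in
-- If the entry comes from a child, that child continues the chain and hence has the same target
-- depth.
theorem attained_kk {v : V} (hv : v ≠ P.root) :
    (NT v (X.src v (X.kk v)) ∧ ¬ P.Anc (P.up v (X.kk v)) (X.src v (X.kk v)) ∧
      X.M v (X.kk v) = w v (X.src v (X.kk v))) ∨
    (X.src v (X.kk v) ≠ P.root ∧ P.par (X.src v (X.kk v)) = v ∧ ¬ NT v (X.src v (X.kk v)) ∧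
      X.kk (X.src v (X.kk v)) = X.kk v ∧
      X.M v (X.kk v) = X.M (X.src v (X.kk v)) (X.kk v) -
        X.M (X.src v (X.kk v)) (P.dep (X.src v (X.kk v)))) := by
  obtain ⟨h1, h2, h3⟩ := X.kk_spec hcross v hv
  rcases X.attained h1 h2 h3 with h | ⟨h4, h5, h6, h7⟩
  · exact Or.inl h
  · refine Or.inr ⟨h4, h5, h6, ?_, h7⟩
    rcases X.kk_eq h4 with ⟨-, -, h8⟩ | ⟨h8, -⟩
    · rw [h8, h5]
    · exact absurd ⟨h5.symm ▸ hv, by rw [h5]⟩ h8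

include hcross in
/-- The chosen links cover every tree edge. -/
theorem exists_chosen_crossing {v : V} (hv : v ≠ P.root) : ∃ x, x ≠ P.root ∧ P.Anc v x ∧
    NT x (X.src x (X.kk x)) ∧ ¬ P.Anc v (X.src x (X.kk x)) := by
  -- The induction needs the stronger claim that the arc leaves the subtree at the target depth,
  -- because this is the property passed along a chain.
  have key : ∀ v, v ≠ P.root → ∃ x, x ≠ P.root ∧ P.Anc v x ∧ NT x (X.src x (X.kk x)) ∧
      ¬ P.Anc (P.up v (X.kk v)) (X.src x (X.kk x)) := by
    intro v
    induction v using P.leaf_induction with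
    | h v ih =>
      intro hv
      rcases X.attained_kk hcross hv with ⟨h1, h2, -⟩ | ⟨h1, h2, -, h4, -⟩
      · exact ⟨v, hv, Anc.refl P v, h1, h2⟩
      · obtain ⟨x, hx, hx1, hx2, hx3⟩ := ih _ h1 h2 h1
        refine ⟨x, hx, ?_, hx2, ?_⟩
        · have := hx1.par_left
          rwa [h2] at this
        · rwa [h4, P.up_par h1 (by rw [h2]; exact (X.kk_spec hcross v hv).2.1), h2] at hx3
  obtain ⟨x, hx, h1, h2, h3⟩ := key v hv
  exact ⟨x, hx, h1, h2, fun h => h3 ((P.up_anc v _).trans h)⟩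

open Classical in
include hcross in
/-- The weight of the chosen links is the value of the dual solution. -/
theorem sum_chosen : ∑ v with (v ≠ P.root ∧ NT v (X.src v (X.kk v))), w v (X.src v (X.kk v)) =
    ∑ v with v ≠ P.root, X.y v := by
  set m : V → ℕ := fun v => (X.M v (X.kk v)).toNat with hm
  have hcoe : ∀ v, v ≠ P.root → (m v : ℕ∞) = X.M v (X.kk v) := fun v hv =>
    ENat.natCast_toNat (X.kk_spec hcross v hv).2.2
  -- These are the vertices that continue the chain of their parent.
  let nt : V → Prop := fun v => P.par v ≠ P.root ∧ X.src (P.par v) (X.kk (P.par v)) = v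
  have h1 : ∀ v ∈ Finset.univ.filter (fun v => v ≠ P.root),
      m v = X.y v + if nt v then m (P.par v) else 0 := by
    intro v hv
    have hv : v ≠ P.root := by simpa using hv
    rcases X.kk_eq hv with ⟨h2, h3, h4⟩ | ⟨h2, h3⟩
    · rw [if_pos ⟨h2, h3⟩]
      have hk := X.kk_spec hcross v hv
      have h5 := X.mono v hk.1 hk.2.1 le_rfl
      rcases X.attained_kk hcross h2 with ⟨-, h6, -⟩ | ⟨-, -, -, -, h6⟩
      · rw [h3] at h6
        exact absurd (P.up_anc _ _).of_par h6
      · rw [h3, ← h4, ← X.coe_y hcross hv, ← hcoe v hv, h4, ← hcoe _ h2] at h6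
        rw [← X.coe_y hcross hv, ← hcoe v hv] at h5
        have h6 : m (P.par v) = m v - X.y v := by exact_mod_cast h6
        have h5 : X.y v ≤ m v := by exact_mod_cast h5
        omega
    · rw [if_neg h2, add_zero]
      simp only [hm, h3, y]
  have h2 := Finset.sum_congr rfl h1
  rw [Finset.sum_add_distrib, ← Finset.sum_filter, Finset.filter_filter] at h2
  -- `par` and `src` are inverse bijections between the vertices that continue a chain and those
  -- whose chain goes on below them. Cancelling these terms leaves the arcs at the lower ends.
  have h3 : ∑ v with (v ≠ P.root ∧ nt v), m (P.par v) =
      ∑ v with (v ≠ P.root ∧ ¬ NT v (X.src v (X.kk v))), m v := by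
    refine Finset.sum_nbij' P.par (fun v => X.src v (X.kk v)) ?_ ?_ ?_ ?_ ?_
    · intro v hv
      obtain ⟨hv, h4, h5⟩ : v ≠ P.root ∧ nt v := by simpa using hv
      simp only [Finset.mem_filter, Finset.mem_univ, true_and]
      refine ⟨h4, ?_⟩
      rcases X.attained_kk hcross h4 with ⟨-, h6, -⟩ | ⟨-, -, h6, -⟩
      · rw [h5] at h6
        exact absurd (P.up_anc _ _).of_par h6
      · exact h6
    · intro v hv
      obtain ⟨hv, h4⟩ : v ≠ P.root ∧ ¬ NT v (X.src v (X.kk v)) := by simpa using hv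
      simp only [Finset.mem_filter, Finset.mem_univ, true_and]
      rcases X.attained_kk hcross hv with ⟨h5, -⟩ | ⟨h5, h6, -⟩
      · exact absurd h5 h4
      · exact ⟨h5, by rw [h6]; exact hv, by rw [h6]⟩
    · intro v hv
      exact (by simpa using hv : v ≠ P.root ∧ nt v).2.2
    · intro v hv
      obtain ⟨hv, h4⟩ : v ≠ P.root ∧ ¬ NT v (X.src v (X.kk v)) := by simpa using hv
      rcases X.attained_kk hcross hv with ⟨h5, -⟩ | ⟨-, h6, -⟩
      · exact absurd h5 h4
      · exact h6
    · intro v _; rfl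
  have h4 : ∑ v with v ≠ P.root, m v =
      ∑ v with (v ≠ P.root ∧ NT v (X.src v (X.kk v))), m v +
      ∑ v with (v ≠ P.root ∧ ¬ NT v (X.src v (X.kk v))), m v := by
    rw [← Finset.filter_filter, ← Finset.filter_filter, Finset.sum_filter_add_sum_filter_not]
  have h5 : ∑ v with (v ≠ P.root ∧ NT v (X.src v (X.kk v))), w v (X.src v (X.kk v)) =
      ∑ v with (v ≠ P.root ∧ NT v (X.src v (X.kk v))), m v := by
    refine Finset.sum_congr rfl fun v hv => ?_
    obtain ⟨hv, h6⟩ : v ≠ P.root ∧ NT v (X.src v (X.kk v)) := by simpa using hv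
    rcases X.attained_kk hcross hv with ⟨-, -, h7⟩ | ⟨-, -, h7, -⟩
    · rw [← hcoe v hv] at h7
      exact_mod_cast h7.symm
    · exact absurd h6 h7
  rw [h5]
  exact Nat.add_right_cancel (h4.symm.trans (h2.trans (congrArg _ h3)))

end CoverTable

/-! ### Augmentations as covers of the tree edges. -/

namespace Congest.TAPInstance

open SimpleGraph ParentTree

variable {V : Type} (X : TAPInstance V)

theorem exists_isParent {v : V} (hv : v ≠ X.root) : ∃ u, X.IsParent u v := by
  obtain ⟨p, hp⟩ := X.tree_isTree.connected.exists_walk_length_eq_dist X.root v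
  have hnil : ¬ p.Nil := fun h => hv h.eq.symm
  refine ⟨p.penultimate, (p.adj_penultimate hnil).symm, ?_⟩
  rcases X.tree_isTree.dist_eq_dist_add_one_of_adj X.root (p.adj_penultimate hnil) with h | h
  · have h1 := dist_le p.dropLast
    have h2 : p.dropLast.length = p.length - 1 := by simp
    omega
  · exact h

/-- Shortest walks from the root through either parent are paths to `v`, and a tree has only one. -/
theorem isParent_unique {u u' v : V} (h : X.IsParent u v) (h' : X.IsParent u' v) : u = u' := by
  obtain ⟨q, hq⟩ := X.tree_isTree.connected.exists_walk_length_eq_dist X.root u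
  obtain ⟨q', hq'⟩ := X.tree_isTree.connected.exists_walk_length_eq_dist X.root u'
  have h1 : (q.concat h.1.symm).IsPath :=
    Walk.isPath_of_length_eq_dist _ (by rw [Walk.length_concat, hq, h.2])
  have h2 : (q'.concat h'.1.symm).IsPath :=
    Walk.isPath_of_length_eq_dist _ (by rw [Walk.length_concat, hq', h'.2])
  have h3 : q.concat h.1.symm = q'.concat h'.1.symm :=
    (X.tree_isTree.existsUnique_path X.root v).unique h1 h2
  simpa using congrArg Walk.penultimate h3

theorem not_isParent_root (u : V) : ¬ X.IsParent u X.root := fun h => by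
  have := h.2
  rw [dist_self] at this
  omega

open Classical in
/-- The rooted tree of the instance. -/
noncomputable def parentTree : ParentTree V where
  root := X.root
  par v := if h : v = X.root then X.root else (X.exists_isParent h).choose
  dep v := X.tree.dist X.root v
  par_root := by simp
  dep_root := by simp
  dep_eq v hv := by rw [dif_neg hv]; exact (X.exists_isParent hv).choose_spec.2

theorem isParent_par {v : V} (hv : v ≠ X.root) : X.IsParent (X.parentTree.par v) v := by
  have : X.parentTree.par v = (X.exists_isParent hv).choose := dif_neg hv
  rw [this]
  exact (X.exists_isParent hv).choose_spec

theorem isParent_iff {u v : V} : X.IsParent u v ↔ v ≠ X.root ∧ X.parentTree.par v = u := by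
  constructor
  · intro h
    have hv : v ≠ X.root := by rintro rfl; exact X.not_isParent_root u h
    exact ⟨hv, X.isParent_unique (X.isParent_par hv) h⟩
  · rintro ⟨hv, rfl⟩
    exact X.isParent_par hv

theorem tree_adj_iff {u v : V} : X.tree.Adj v u ↔ X.IsParent u v ∨ X.IsParent v u := by
  constructor
  · intro h
    rcases X.tree_isTree.dist_eq_dist_add_one_of_adj X.root h with h' | h'
    · exact Or.inl ⟨h, h'⟩
    · exact Or.inr ⟨h.symm, h'⟩
  · rintro (h | h)
    · exact h.1
    · exact h.1.symm

/-- `u` is joined to `v` by an edge outside the tree. -/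
def Link (v u : V) : Prop := X.graph.Adj v u ∧ ¬ X.tree.Adj v u

/-- A walk from `v` to the root that avoids the edge above `v` must leave the subtree of `v`, and
that edge is the only tree edge doing so. -/
theorem exists_crossing {H : SimpleGraph V} (hH : H.IsEdgeConnected 2) {v : V} (hv : v ≠ X.root) :
    ∃ x u, H.Adj x u ∧ ¬ X.tree.Adj x u ∧ X.parentTree.Anc v x ∧ ¬ X.parentTree.Anc v u := by
  obtain ⟨p⟩ := isEdgeConnected_two.1 hH s(v, X.parentTree.par v) v X.root
  obtain ⟨d, hd, h1, h2⟩ := p.exists_boundary_dart {x | X.parentTree.Anc v x} (Anc.refl _ v)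
    (fun h => hv (by
      have := Anc.dep_le h
      rw [show X.root = X.parentTree.root from rfl, X.parentTree.dep_root] at this
      exact X.parentTree.eq_root_iff.2 (by omega)))
  have hadj := d.adj
  rw [deleteEdges_adj] at hadj
  refine ⟨d.fst, d.snd, hadj.1, fun ht => ?_, h1, h2⟩
  rcases X.tree_adj_iff.1 ht with h | h
  · obtain ⟨h3, h4⟩ := X.isParent_iff.1 h
    rcases Anc.eq_or h1 with h5 | h5
    · refine hadj.2 ?_
      rw [Set.mem_singleton_iff, ← h4, ← h5]
    · exact h2 (h4 ▸ h5)
  · obtain ⟨h3, h4⟩ := X.isParent_iff.1 h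
    exact h2 (Anc.of_par (h4.symm ▸ h1))

theorem reachable_iterate_par {H : SimpleGraph V} {x : V} {i : ℕ}
    (h : ∀ j < i, X.parentTree.par^[j] x ≠ X.root →
      H.Adj (X.parentTree.par^[j] x) (X.parentTree.par (X.parentTree.par^[j] x))) :
    H.Reachable x (X.parentTree.par^[i] x) := by
  induction i with
  | zero => exact .refl x
  | succ i ih =>
    refine (ih fun j hj => h j (by omega)).trans ?_
    rw [Function.iterate_succ_apply']
    by_cases hr : X.parentTree.par^[i] x = X.root
    · rw [hr, show X.root = X.parentTree.root from rfl, X.parentTree.par_root]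
    · exact (h i (by omega) hr).reachable

/-- Deleting the edge above `v` leaves the subtree of `v` and its complement connected by parent
steps, and the crossing link joins them. Deleting anything else leaves the tree intact. -/
theorem isAugmentation_of_crossing {S : Finset (Sym2 V)}
    (hS : (S : Set (Sym2 V)) ⊆ X.graph.edgeSet)
    (h : ∀ v, v ≠ X.root → ∃ x u, s(x, u) ∈ S ∧ ¬ X.tree.Adj x u ∧ X.parentTree.Anc v x ∧
      ¬ X.parentTree.Anc v u) : X.IsAugmentation S := by
  refine ⟨hS, isEdgeConnected_two.2 fun e => ?_⟩
  set H := (X.tree ⊔ fromEdgeSet (S : Set (Sym2 V))).deleteEdges {e} with hH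
  have htree : ∀ {z}, z ≠ X.root → s(z, X.parentTree.par z) ≠ e → H.Adj z (X.parentTree.par z) :=
    fun hz he => by
      rw [hH, deleteEdges_adj]
      exact ⟨Or.inl (X.isParent_par hz).1, he⟩
  suffices hroot : ∀ x, H.Reachable x X.root from fun x y => (hroot x).trans (hroot y).symm
  by_cases he : ∃ v, v ≠ X.root ∧ s(v, X.parentTree.par v) = e
  · obtain ⟨v, hv, rfl⟩ := he
    have hne : ∀ {z}, z ≠ X.root → z ≠ v → H.Adj z (X.parentTree.par z) := by
      intro z hz hzv
      refine htree hz fun heq => ?_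
      rw [Sym2.eq_iff] at heq
      rcases heq with ⟨h1, -⟩ | ⟨h1, h2⟩
      · exact hzv h1
      · have h3 := X.parentTree.dep_eq z hz
        have h4 := X.parentTree.dep_eq v hv
        rw [h2] at h3
        rw [← h1] at h4
        omega
    have hout : ∀ {x}, ¬ X.parentTree.Anc v x → H.Reachable x X.root := by
      intro x hx
      have h1 : H.Reachable x (X.parentTree.par^[X.parentTree.dep x] x) :=
        X.reachable_iterate_par fun j _ hj => hne hj fun h => hx ⟨j, h⟩
      rwa [X.parentTree.iterate_eq_root le_rfl] at h1
    have hin : ∀ {x}, X.parentTree.Anc v x → H.Reachable x v := by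
      classical
      intro x hx
      have h1 : H.Reachable x (X.parentTree.par^[Nat.find hx] x) :=
        X.reachable_iterate_par fun j hj hjr => hne hjr (Nat.find_min hx hj)
      rwa [Nat.find_spec hx] at h1
    have hvr : H.Reachable v X.root := by
      obtain ⟨x, u, h1, h2, h3, h4⟩ := h v hv
      refine (hin h3).symm.trans (Reachable.trans (Adj.reachable ?_) (hout h4))
      rw [hH, deleteEdges_adj]
      refine ⟨Or.inr ((fromEdgeSet_adj _).2 ⟨h1, fun h => h4 (h ▸ h3)⟩), fun h => ?_⟩
      have h5 : X.tree.Adj x u := by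
        rw [← mem_edgeSet, Set.mem_singleton_iff.1 h]
        exact (X.isParent_par hv).1
      exact h2 h5
    intro x
    by_cases hx : X.parentTree.Anc v x
    · exact (hin hx).trans hvr
    · exact hout hx
  · intro x
    have h1 : H.Reachable x (X.parentTree.par^[X.parentTree.dep x] x) :=
      X.reachable_iterate_par fun j _ hj => htree hj fun h => he ⟨_, hj, h⟩
    rwa [X.parentTree.iterate_eq_root le_rfl] at h1

theorem link_crossing {X : TAPInstance V} (v : V) (hv : v ≠ X.root) :
    ∃ x u, X.Link x u ∧ X.parentTree.Anc v x ∧ ¬ X.parentTree.Anc v u := by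
  obtain ⟨x, u, h1, h2, h3⟩ := X.exists_crossing X.graph_isEdgeConnected_two hv
  exact ⟨x, u, ⟨h1, h2⟩, h3⟩

variable [Fintype V]

theorem dep_le_height (v : V) : X.parentTree.dep v ≤ X.height :=
  Finset.le_sup (f := fun v => X.tree.dist X.root v) (Finset.mem_univ v)

theorem exists_dep_eq_height : ∃ v, X.parentTree.dep v = X.height := by
  obtain ⟨v, -, hv⟩ := Finset.exists_mem_eq_sup Finset.univ ⟨X.root, Finset.mem_univ _⟩
    fun v => X.tree.dist X.root v
  exact ⟨v, hv.symm⟩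

theorem height_lt_card : X.height < Fintype.card V := by
  obtain ⟨v, hv⟩ := X.exists_dep_eq_height
  obtain ⟨p, hp, hl⟩ := X.tree_isTree.connected.exists_path_of_dist X.root v
  rw [← hv]
  exact hl.symm.trans_lt hp.length_lt

variable [DecidableEq V] {X}

open Classical in
/-- The set of links chosen by a solution of the dynamic program. -/
noncomputable def chosen (Y : CoverTable X.parentTree X.Link fun v u => X.weight s(v, u)) :
    Finset (Sym2 V) :=
  (Finset.univ.filter fun v => v ≠ X.root ∧ X.Link v (Y.src v (Y.kk v))).image fun v => s(v, Y.src v (Y.kk v))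

theorem mem_chosen {Y : CoverTable X.parentTree X.Link fun v u => X.weight s(v, u)} {e : Sym2 V} :
    e ∈ chosen Y ↔ ∃ v, (v ≠ X.root ∧ X.Link v (Y.src v (Y.kk v))) ∧ s(v, Y.src v (Y.kk v)) = e := by
  simp [chosen]

theorem isAugmentation_chosen (Y : CoverTable X.parentTree X.Link fun v u => X.weight s(v, u)) :
    X.IsAugmentation (chosen Y) := by
  refine X.isAugmentation_of_crossing ?_ fun v hv => ?_
  · intro e he
    obtain ⟨v, hv, rfl⟩ := mem_chosen.1 he
    exact hv.2.1
  · obtain ⟨x, h1, h2, h3, h4⟩ := Y.exists_chosen_crossing link_crossing hv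
    exact ⟨x, _, mem_chosen.2 ⟨x, ⟨h1, h3⟩, rfl⟩, h3.2, h2, h4⟩

theorem cost_chosen_le (Y : CoverTable X.parentTree X.Link fun v u => X.weight s(v, u))
    {S : Finset (Sym2 V)} (hS : X.IsAugmentation S) : X.cost (chosen Y) ≤ 2 * X.cost S := by
  classical
  -- Both orientations of the non-tree edges in `S`: the source of the factor 2.
  set D : Finset (V × V) := Finset.univ.filter fun d => s(d.1, d.2) ∈ S ∧ X.Link d.1 d.2 with hD
  have h3 := Y.sum_y_le link_crossing D (fun d hd => (Finset.mem_filter.1 hd).2.2) fun v hv => by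
    obtain ⟨x, u, h4, h5, h6, h7⟩ := X.exists_crossing hS.2 hv
    have h8 := (h4.resolve_left h5)
    rw [fromEdgeSet_adj] at h8
    exact ⟨(x, u), Finset.mem_filter.2 ⟨Finset.mem_univ _, h8.1, hS.1 h8.1, h5⟩, h6, h7⟩
  have h4 : ∑ d ∈ D, X.weight s(d.1, d.2) ≤ 2 * X.cost S := by
    rw [cost, Finset.mul_sum,
      ← Finset.sum_fiberwise_of_maps_to (t := S) (g := fun d : V × V => s(d.1, d.2))
        (fun d hd => (Finset.mem_filter.1 hd).2.1)]
    refine Finset.sum_le_sum fun e _ => ?_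
    rw [Finset.sum_congr rfl (g := fun _ => X.weight e)
      (fun d hd => by rw [(Finset.mem_filter.1 hd).2]), Finset.sum_const, smul_eq_mul]
    refine Nat.mul_le_mul_right _ ?_
    induction e using Sym2.ind with
    | _ a b =>
      refine (Finset.card_le_card (t := {(a, b), (b, a)}) ?_).trans Finset.card_le_two
      intro d hd
      simpa [Prod.ext_iff] using (Finset.mem_filter.1 hd).2
  refine le_trans ?_ ((Y.sum_chosen link_crossing).le.trans (h3.trans h4))
  -- Two chosen arcs may be the same undirected edge; merging them only lowers the cost.
  refine (Finset.sum_image_le_of_nonneg (by simp)).trans_eq (Finset.sum_congr ?_ fun _ _ => rfl)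
  ext v
  simp only [Finset.mem_filter, Finset.mem_univ, true_and]
  rfl

end Congest.TAPInstance

/-! ### Algorithms that remember everything received. -/

namespace Congest

/-- The messages received by a vertex, decoded as natural numbers, by round and port. -/
abbrev History := ℕ → ℕ → Option ℕ

/-- The number with the given binary digits, least significant digit first. -/
def decodeBits (l : List Bool) : ℕ := l.foldr Nat.bit 0

theorem decodeBits_bits (n : ℕ) : decodeBits n.bits = n := by
  induction n using Nat.binaryRec' with
  | zero => simp [decodeBits]
  | bit b n h ih => rw [Nat.bits_append_bit _ _ h]; simpa [decodeBits] using congrArg (Nat.bit b) ih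

section HistoryAlgorithm

variable {I O : Type} (send : I → History → ℕ → ℕ → Option ℕ) (out : I → History → ℕ → Option O)

/-- The algorithm in which every vertex remembers everything that it received, and computes its
messages `send i H t p` and its output `out i H t` from its input `i`, its history `H` and the
number `t` of rounds so far. -/
def historyAlgorithm : Algorithm I O where
  State := I × ℕ × History
  init i := (i, 0, fun _ _ => none)
  send s p := (send s.1 s.2.2 s.2.1 p).map Nat.bits
  receive s box := (s.1, s.2.1 + 1, Function.update s.2.2 s.2.1 fun p => (box p).map decodeBits)
  output s := out s.1 s.2.2 s.2.1

variable {V : Type} [DecidableEq V] (N : Network V) (inp : V → I)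

/-- The history of every vertex after `t` rounds if no vertex halts. -/
def hist : ℕ → V → History
  | 0 => fun _ _ _ => none
  | t + 1 => fun v => Function.update (hist t v) t fun p =>
      (N.nbrs v)[p]?.bind fun u => send (inp u) (hist t u) t ((N.nbrs u).idxOf v)

/-- Everything that `v` ever receives if no vertex halts. -/
def fullHist (v : V) : History := fun t p =>
  (N.nbrs v)[p]?.bind fun u => send (inp u) (hist send N inp t u) t ((N.nbrs u).idxOf v)

theorem hist_eq_fullHist {s t : ℕ} (h : s < t) (v : V) :
    hist send N inp t v s = fullHist send N inp v s := by
  induction t with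
  | zero => omega
  | succ t ih =>
    by_cases hs : s = t
    · subst hs
      simp only [hist, Function.update_self]
      rfl
    · simp only [hist]
      rw [Function.update_of_ne hs, ih (by omega)]

variable {send out N inp} {T : ℕ}

/-- Before time `T` no vertex is silenced by halting, and decoding inverts the bit encoding, so the
execution follows the recursion on numbers. -/
theorem run_eq_hist (hT : ∀ t < T, ∀ v, out (inp v) (hist send N inp t v) t = none) {t : ℕ}
    (ht : t ≤ T) (v : V) :
    (historyAlgorithm send out).run N inp t v = (inp v, t, hist send N inp t v) := by
  induction t generalizing v with
  | zero => rfl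
  | succ t ih =>
    have h1 := fun v => ih (by omega) v
    have h2 : ∀ v, (historyAlgorithm send out).output
        ((historyAlgorithm send out).run N inp t v) = none := fun v => by
      rw [h1]; exact hT t (by omega) v
    have h3 : ∀ u q, (historyAlgorithm send out).outgoing
        ((historyAlgorithm send out).run N inp t u) q =
          (send (inp u) (hist send N inp t u) t q).map Nat.bits := fun u q => by
      unfold Algorithm.outgoing
      rw [h2, h1]
      rfl
    have h4 : (historyAlgorithm send out).run N inp (t + 1) v =
        (historyAlgorithm send out).receive ((historyAlgorithm send out).run N inp t v)
          ((historyAlgorithm send out).inbox N ((historyAlgorithm send out).run N inp t) v) := by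
      simp [Algorithm.run, h2]
    have h5 : (fun p => ((historyAlgorithm send out).inbox N
        ((historyAlgorithm send out).run N inp t) v p).map decodeBits) =
        fullHist send N inp v t := by
      funext p
      unfold Algorithm.inbox fullHist
      cases (N.nbrs v)[p]? with
      | none => rfl
      | some u => simp [h3, Option.map_map, Function.comp_def, decodeBits_bits]
    rw [h4, h1]
    exact Prod.ext rfl (Prod.ext rfl (congrArg (Function.update (hist send N inp t v) t) h5))

variable {o : V → O}

theorem run_output (hT : ∀ t < T, ∀ v, out (inp v) (hist send N inp t v) t = none)
    (ho : ∀ v, out (inp v) (hist send N inp T v) T = some (o v)) {t : ℕ} (ht : T ≤ t) (v : V) :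
    (historyAlgorithm send out).output ((historyAlgorithm send out).run N inp t v) =
      some (o v) := by
  induction t, ht using Nat.le_induction with
  | base => rw [run_eq_hist hT le_rfl]; exact ho v
  | succ t _ ih => simp [Algorithm.run, ih]

theorem historyAlgorithm_haltsWithin
    (hT : ∀ t < T, ∀ v, out (inp v) (hist send N inp t v) t = none)
    (ho : ∀ v, out (inp v) (hist send N inp T v) T = some (o v)) {R : ℕ} (hR : T ≤ R) :
    (historyAlgorithm send out).HaltsWithin N inp R o :=
  fun v => run_output hT ho hR v

theorem historyAlgorithm_messagesBoundedBy {B : ℕ}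
    (hT : ∀ t < T, ∀ v, out (inp v) (hist send N inp t v) t = none)
    (ho : ∀ v, out (inp v) (hist send N inp T v) T = some (o v))
    (hB : ∀ t < T, ∀ v, ∀ p < (N.nbrs v).length, ∀ m,
      send (inp v) (hist send N inp t v) t p = some m → m < 2 ^ B) :
    (historyAlgorithm send out).MessagesBoundedBy N inp B := by
  intro t v p m hp hm
  unfold Algorithm.outgoing at hm
  rcases lt_or_ge t T with ht | ht
  · rw [run_eq_hist hT ht.le] at hm
    split_ifs at hm
    obtain ⟨k, hk, rfl⟩ := Option.map_eq_some_iff.1 hm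
    rw [Nat.size_eq_bits_len, Nat.size_le]
    exact hB t ht v p hp k hk
  · rw [run_output hT ho ht] at hm
    simp at hm

end HistoryAlgorithm

end Congest

/-! ### The program of a vertex. -/

namespace Congest.VertexInput

open Classical

variable (i : VertexInput) (H : History)

/-- The port `p` leads to a child. -/
def IsChildPort (p : ℕ) : Prop := ∃ q, i.ports[p]? = some q ∧ q.inTree = true ∧ q.toParent = false

/-- The port `p` leads to a vertex that is not a neighbor in the tree. -/
def IsLinkPort (p : ℕ) : Prop := ∃ q, i.ports[p]? = some q ∧ q.inTree = false

/-- No port leads to a parent. -/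
def IsRoot : Prop := ∀ q ∈ i.ports, q.toParent = false

/-- The port that leads to the parent. -/
def parentPort : ℕ := i.ports.findIdx PortInput.toParent

/-- The successor of the identifier of the ancestor at distance `t`, or `0` if there is none. -/
def ancCode : ℕ → ℕ
  | 0 => i.ident + 1
  | t + 1 => ((H t i.parentPort).map (· / 4)).getD 0

/-- The subtree of the vertex has height at most `t`. -/
def Low (t : ℕ) : Prop :=
  ∀ p, i.IsChildPort p → ∃ s m, t = s + 1 ∧ H s p = some m ∧ m % 2 = 1

/-- The root knew the height of the tree when it sent what has arrived in the first `t` rounds. -/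
def Informed (t : ℕ) : Prop :=
  if i.IsRoot then i.Low H t else ∃ s m, t = s + 1 ∧ H s i.parentPort = some m ∧ m / 2 % 2 = 1

/-- The message sent through all ports in round `t` of the first phase. -/
noncomputable def firstMessage (t : ℕ) : ℕ :=
  4 * i.ancCode H t + (if i.Informed H t then 2 else 0) + (if i.Low H t then 1 else 0)

/-- The depth of the vertex. -/
noncomputable def depth : ℕ := sInf {t | i.ancCode H (t + 1) = 0}

/-- The height of the tree. -/
noncomputable def height : ℕ := sInf {t | i.Informed H t} - i.depth H

/-- The first phase, which lasts for twice as many rounds as the height of the tree, is over after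
`t` rounds. -/
def Ready (t : ℕ) : Prop := ∃ s ≤ t, i.Informed H s ∧ 2 * (s - i.depth H) ≤ t

/-- Messages that encode extended natural numbers. -/
def decodeENat : Option ℕ → ℕ∞
  | none => ⊤
  | some m => m

noncomputable def encodeENat (x : ℕ∞) : Option ℕ := if x = ⊤ then none else some x.toNat

theorem decodeENat_encodeENat (x : ℕ∞) : decodeENat (encodeENat x) = x := by
  unfold encodeENat
  split_ifs with h
  · exact h.symm
  · exact ENat.natCast_toNat h

variable (D h : ℕ)

/-- The least reduced weight of a link through the port `p` of a vertex of depth `D` that covers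
the tree edges up to the ancestor at depth `k`, in a tree of height `h`. -/
noncomputable def portValue (k p : ℕ) : ℕ∞ :=
  match i.ports[p]? with
  | none => ⊤
  | some q =>
    if q.inTree then
      -- A child has depth `D + 1` and sends its entry for `k` in this round, just before the vertex
      -- itself passes on its own entry for `k`.
      if q.toParent then ⊤ else decodeENat (H (4 * h - (D + 1) - k) p)
    -- Codes of genuine ancestors are positive, so the `0` announced beyond the root never matches.
    else if ∃ s < 2 * h, ∃ m, H s p = some m ∧ m / 4 = i.ancCode H (D - k) then ⊤
    else q.weight

noncomputable def minValue (k : ℕ) : ℕ∞ := (Finset.range i.ports.length).inf (i.portValue H D h k)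

/-- A port with the least value. -/
noncomputable def minPort (k : ℕ) : ℕ :=
  sInf {p | p < i.ports.length ∧ i.portValue H D h k p = i.minValue H D h k}

/-- The message sent to the parent in round `t` of the second phase. -/
noncomputable def secondMessage (t : ℕ) : Option ℕ :=
  let k := 4 * h - D - t
  -- The entry for `k = D` concerns only the edge to the parent and is of no use above it.
  if 1 ≤ k ∧ k < D then encodeENat (i.minValue H D h k - i.minValue H D h D) else none

/-- The depth up to which the chosen link that covers the edge to the parent is known to reach. -/
def reach : ℕ := (H (4 * h + D - 1) i.parentPort).getD D

/-- The message sent in round `t` of the third phase through the port `p`. -/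
noncomputable def thirdMessage (t p : ℕ) : Option ℕ :=
  -- The port may lead along a link instead of to a child. This is harmless, since `reach` reads
  -- only the parent port.
  if t = 4 * h + D ∧ 0 < D ∧ p = i.minPort H D h (i.reach H D h) then some (i.reach H D h) else none

/-- The vertex chooses the edge at the port `p`. -/
def Chooses (p : ℕ) : Prop := 0 < D ∧ i.IsLinkPort p ∧ p = i.minPort H D h (i.reach H D h)

/-- The messages of the algorithm. -/
noncomputable def message (t p : ℕ) : Option ℕ :=
  let D := i.depth H
  let h := i.height H
  if i.Ready H t then
    if t < 4 * h then i.secondMessage H D h t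
    else if t < 5 * h then i.thirdMessage H D h t p
    else if i.Chooses H D h p then some 1 else none
  else some (i.firstMessage H t)

/-- The output of the algorithm. -/
noncomputable def result (t : ℕ) : Option (Finset ℕ) :=
  let D := i.depth H
  let h := i.height H
  -- A tree of height `0` allows no rounds, so an isolated vertex must halt at once.
  if i.ports = [] then some ∅
  else if i.Ready H t ∧ 5 * h + 1 ≤ t then
    some ((Finset.range i.ports.length).filter fun p =>
      i.IsLinkPort p ∧ (i.Chooses H D h p ∨ (H (5 * h) p).isSome))
  else none

/-! ### Computations in round `t` depend only on earlier rounds. -/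

section Congruence

variable {i H D h} {H' : History} {t : ℕ}

theorem ancCode_congr (hH : ∀ s < t, H s = H' s) {s : ℕ} (hs : s ≤ t) :
    i.ancCode H s = i.ancCode H' s := by
  cases s with
  | zero => rfl
  | succ s => simp only [ancCode]; rw [hH s (by omega)]

theorem portValue_congr (hH : ∀ s < t, H s = H' s) {k : ℕ} (hk : 4 * h - (D + 1) - k < t)
    (ht : 2 * h ≤ t) (hD : D ≤ h) : i.portValue H D h k = i.portValue H' D h k := by
  funext p
  unfold portValue
  cases i.ports[p]? with
  | none => rfl
  | some q =>
    have h1 : (∃ s < 2 * h, ∃ m, H s p = some m ∧ m / 4 = i.ancCode H (D - k)) ↔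
        ∃ s < 2 * h, ∃ m, H' s p = some m ∧ m / 4 = i.ancCode H' (D - k) := by
      rw [ancCode_congr hH (show D - k ≤ t by omega)]
      refine exists_congr fun s => and_congr_right fun hs => ?_
      rw [hH s (by omega)]
    simp only [hH _ hk, h1]

theorem minValue_congr (hH : ∀ s < t, H s = H' s) {k : ℕ} (hk : 4 * h - (D + 1) - k < t)
    (ht : 2 * h ≤ t) (hD : D ≤ h) : i.minValue H D h k = i.minValue H' D h k := by
  unfold minValue
  rw [portValue_congr hH hk ht hD]

theorem minPort_congr (hH : ∀ s < t, H s = H' s) {k : ℕ} (hk : 4 * h - (D + 1) - k < t)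
    (ht : 2 * h ≤ t) (hD : D ≤ h) : i.minPort H D h k = i.minPort H' D h k := by
  unfold minPort
  rw [portValue_congr hH hk ht hD, minValue_congr hH hk ht hD]

/-- The children's entries for `k` arrive in round `t - 1`, and those for `D > k` even earlier, so
the pipeline never waits. -/
theorem secondMessage_congr (hH : ∀ s < t, H s = H' s) (ht : 2 * h ≤ t) (hD : D ≤ h) :
    i.secondMessage H D h t = i.secondMessage H' D h t := by
  unfold secondMessage
  simp only
  split_ifs with hk
  · rw [minValue_congr hH (by omega) ht hD, minValue_congr hH (by omega) ht hD]
  · rfl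

theorem reach_congr (hH : ∀ s < t, H s = H' s) (ht : 4 * h + D ≤ t) (h0 : 0 < D) :
    i.reach H D h = i.reach H' D h := by
  unfold reach
  rw [hH _ (by omega)]

theorem minPort_reach_congr (hH : ∀ s < t, H s = H' s) (ht : 4 * h + D ≤ t) (h0 : 0 < D)
    (hD : D ≤ h) :
    i.minPort H D h (i.reach H D h) = i.minPort H' D h (i.reach H' D h) := by
  rw [reach_congr hH ht h0, minPort_congr hH (by omega) (by omega) hD]

theorem thirdMessage_congr (hH : ∀ s < t, H s = H' s) (hD : D ≤ h) (p : ℕ) :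
    i.thirdMessage H D h t p = i.thirdMessage H' D h t p := by
  unfold thirdMessage
  by_cases h1 : t = 4 * h + D ∧ 0 < D
  · rw [minPort_reach_congr hH h1.1.ge h1.2 hD, reach_congr hH h1.1.ge h1.2]
  · rw [if_neg fun h => h1 ⟨h.1, h.2.1⟩, if_neg fun h => h1 ⟨h.1, h.2.1⟩]

theorem chooses_congr (hH : ∀ s < t, H s = H' s) (ht : 5 * h ≤ t) (hD : D ≤ h) (p : ℕ) :
    i.Chooses H D h p ↔ i.Chooses H' D h p := by
  unfold Chooses
  refine and_congr_right fun h0 => ?_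
  rw [minPort_reach_congr hH (by omega) h0 hD]

end Congruence

end Congest.VertexInput

/-! ### Ports, and correctness of the first phase. -/

namespace Congest.TAPInstance

open Classical ParentTree VertexInput

variable {V : Type} (X : TAPInstance V)

section Ports

variable {X}

theorem input_ports {v u : V} {p : ℕ} (h : (X.nbrs v)[p]? = some u) :
    (X.input v).ports[p]? = some { weight := X.weight s(v, u)
                                   inTree := decide (X.tree.Adj v u)
                                   toParent := decide (X.IsParent u v) } := by
  simp [input, h]

theorem length_input_ports (v : V) : (X.input v).ports.length = (X.nbrs v).length := by
  simp [input]

theorem exists_port {v u : V} (h : X.graph.Adj v u) : ∃ p : ℕ, (X.nbrs v)[p]? = some u :=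
  List.mem_iff_getElem?.1 ((X.mem_nbrs v u).2 h)

theorem adj_of_port {v u : V} {p : ℕ} (h : (X.nbrs v)[p]? = some u) : X.graph.Adj v u :=
  (X.mem_nbrs v u).1 (List.mem_iff_getElem?.2 ⟨p, h⟩)

theorem port_lt {v u : V} {p : ℕ} (h : (X.nbrs v)[p]? = some u) :
    p < (X.input v).ports.length := by
  rw [length_input_ports]
  exact (List.getElem?_eq_some_iff.1 h).1

theorem port_unique {v u : V} {p q : ℕ} (hp : (X.nbrs v)[p]? = some u)
    (hq : (X.nbrs v)[q]? = some u) : p = q := by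
  obtain ⟨hp1, hp2⟩ := List.getElem?_eq_some_iff.1 hp
  obtain ⟨hq1, hq2⟩ := List.getElem?_eq_some_iff.1 hq
  exact (X.nodup_nbrs v).getElem_inj_iff.1 (hp2.trans hq2.symm)

theorem exists_nbr {v : V} {p : ℕ} (h : p < (X.input v).ports.length) :
    ∃ u, (X.nbrs v)[p]? = some u := by
  rw [length_input_ports] at h
  exact ⟨_, List.getElem?_eq_getElem h⟩

theorem port_idxOf [DecidableEq V] {v u : V} (h : X.graph.Adj v u) :
    (X.nbrs v)[(X.nbrs v).idxOf u]? = some u := by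
  have h1 : u ∈ X.nbrs v := (X.mem_nbrs v u).2 h
  rw [List.getElem?_eq_getElem (List.idxOf_lt_length_iff.2 h1), List.getElem_idxOf]

theorem exists_nbr_of_port {v : V} {p : ℕ} {q : PortInput} (h : (X.input v).ports[p]? = some q) :
    ∃ u, (X.nbrs v)[p]? = some u :=
  exists_nbr (List.getElem?_eq_some_iff.1 h).1

theorem isChildPort_iff {v u : V} {p : ℕ} (h : (X.nbrs v)[p]? = some u) :
    (X.input v).IsChildPort p ↔ X.IsParent v u := by
  simp only [IsChildPort, input_ports h, Option.some.injEq]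
  constructor
  · rintro ⟨q, rfl, h1, h2⟩
    exact (X.tree_adj_iff.1 (by simpa using h1)).resolve_left (by simpa using h2)
  · intro h1
    refine ⟨_, rfl, by simpa using h1.1.symm, ?_⟩
    simp only [decide_eq_false_iff_not]
    intro h2
    have := h1.2
    have := h2.2
    omega

theorem isLinkPort_iff {v u : V} {p : ℕ} (h : (X.nbrs v)[p]? = some u) :
    (X.input v).IsLinkPort p ↔ X.Link v u := by
  simp [IsLinkPort, input_ports h, Link, adj_of_port h]

theorem nbrs_parentPort {v : V} (hv : v ≠ X.root) :
    (X.nbrs v)[(X.input v).parentPort]? = some (X.parentTree.par v) := by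
  have hp := X.isParent_par hv
  obtain ⟨p, h1⟩ := exists_port (X.tree_le hp.1)
  have h2 : ∃ q ∈ (X.input v).ports, q.toParent = true :=
    ⟨_, List.mem_iff_getElem?.2 ⟨p, input_ports h1⟩, by simpa using hp⟩
  have h3 := List.findIdx_lt_length_of_exists h2
  obtain ⟨u, hu⟩ := exists_nbr h3
  have h4 := List.findIdx_getElem (w := h3)
  have h5 := (List.getElem?_eq_some_iff.1 (input_ports hu)).2
  rw [h5] at h4
  have h6 : X.IsParent u v := by simpa using h4
  rw [X.isParent_unique hp h6]
  exact hu

theorem isRoot_iff {v : V} : (X.input v).IsRoot ↔ v = X.root := by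
  constructor
  · intro h
    by_contra hv
    have h1 := input_ports (nbrs_parentPort hv)
    have h2 := h _ (List.mem_iff_getElem?.2 ⟨_, h1⟩)
    simp only [decide_eq_false_iff_not] at h2
    exact h2 (X.isParent_par hv)
  · rintro rfl q hq
    obtain ⟨p, hp⟩ := List.mem_iff_getElem?.1 hq
    obtain ⟨u, hu⟩ := exists_nbr_of_port hp
    rw [input_ports hu] at hp
    obtain rfl := Option.some.inj hp
    simpa using X.not_isParent_root u

end Ports

section FirstPhase

/-- The identifier plus one of the ancestor of `v` at distance `t`, or `0` if there is none. -/
noncomputable def ancId (v : V) (t : ℕ) : ℕ :=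
  if t ≤ X.parentTree.dep v then X.ident (X.parentTree.par^[t] v) + 1 else 0

/-- The subtree of `v` has height at most `t`. -/
def LowAt (v : V) (t : ℕ) : Prop :=
  ∀ x, X.parentTree.Anc v x → X.parentTree.dep x ≤ X.parentTree.dep v + t

variable {X} {v : V} {H : History} {t : ℕ}

theorem getElem?_parentPort_root : (X.nbrs X.root)[(X.input X.root).parentPort]? = none := by
  rw [List.getElem?_eq_none_iff, ← length_input_ports]
  refine (List.findIdx_eq_length.2 ?_).ge
  intro q hq
  exact isRoot_iff.2 rfl q hq

theorem lowAt_zero_iff : X.LowAt v 0 ↔ ∀ c, ¬ X.IsParent v c := by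
  constructor
  · intro h c hc
    obtain ⟨h1, h2⟩ := X.isParent_iff.1 hc
    have h3 := h c ⟨1, h2⟩
    have h4 := X.parentTree.dep_eq c h1
    rw [h2] at h4
    omega
  · rintro h x ⟨i, hi⟩
    induction i generalizing x with
    | zero => exact (congrArg _ hi).le
    | succ i ih =>
      rw [Function.iterate_succ_apply'] at hi
      by_cases hr : X.parentTree.par^[i] x = X.root
      · rw [hr, show X.root = X.parentTree.root from rfl, X.parentTree.par_root] at hi
        exact ih x (hr.trans hi)
      · exact absurd (X.isParent_iff.2 ⟨hr, hi⟩) (h _)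

theorem exists_isParent_of_anc {x : V} (h : X.parentTree.Anc v x) (hx : x ≠ v) :
    ∃ c, X.IsParent v c ∧ X.parentTree.Anc c x := by
  obtain ⟨i, hi⟩ := h
  induction i generalizing x with
  | zero => exact absurd hi hx
  | succ i ih =>
    have hxr : x ≠ X.root := by
      rintro rfl
      have h1 : ∀ j, X.parentTree.par^[j] X.root = X.root := fun j =>
        X.parentTree.iterate_eq_root (by
          rw [show X.root = X.parentTree.root from rfl, X.parentTree.dep_root]; omega)
      exact hx ((h1 (i + 1)).symm.trans hi)
    rw [Function.iterate_succ_apply] at hi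
    by_cases hp : X.parentTree.par x = v
    · exact ⟨x, X.isParent_iff.2 ⟨hxr, hp⟩, Anc.refl _ x⟩
    · obtain ⟨c, h1, h2⟩ := ih hp hi
      exact ⟨c, h1, h2.of_par⟩

theorem lowAt_succ_iff {s : ℕ} : X.LowAt v (s + 1) ↔ ∀ c, X.IsParent v c → X.LowAt c s := by
  constructor
  · intro h c hc x hx
    obtain ⟨h1, h2⟩ := X.isParent_iff.1 hc
    have h3 := h x (h2 ▸ hx.par_left)
    have h4 := X.parentTree.dep_eq c h1
    rw [h2] at h4
    omega
  · intro h x hx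
    by_cases hxv : x = v
    · rw [hxv]; omega
    · obtain ⟨c, h1, h2⟩ := exists_isParent_of_anc hx hxv
      have h3 := h c h1 x h2
      obtain ⟨h4, h5⟩ := X.isParent_iff.1 h1
      have h6 := X.parentTree.dep_eq c h4
      rw [h5] at h6
      omega

variable [Fintype V] (X)

/-- The message that `v` sends in round `t` of the first phase. -/
noncomputable def announce (v : V) (t : ℕ) : ℕ :=
  4 * X.ancId v t + (if X.height + X.parentTree.dep v ≤ t then 2 else 0) +
    (if X.LowAt v t then 1 else 0)

theorem announce_div (v : V) (t : ℕ) : X.announce v t / 4 = X.ancId v t := by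
  unfold announce; split_ifs <;> omega

theorem announce_mod (v : V) (t : ℕ) : X.announce v t % 2 = 1 ↔ X.LowAt v t := by
  unfold announce; split_ifs with h1 h2 <;> simp [*] <;> omega

theorem announce_div_mod (v : V) (t : ℕ) :
    X.announce v t / 2 % 2 = 1 ↔ X.height + X.parentTree.dep v ≤ t := by
  unfold announce; split_ifs with h1 h2 <;> omega

/-- In the first `t` rounds of the history `H`, the vertex `v` received what its neighbors announce
in the first phase. -/
def Heard (v : V) (H : History) (t : ℕ) : Prop :=
  ∀ s < t, ∀ p, H s p = (X.nbrs v)[p]?.map fun u => X.announce u s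

variable {X}

theorem Heard.eq_some (hH : X.Heard v H t) {s p : ℕ} {u : V} (hs : s < t)
    (hu : (X.nbrs v)[p]? = some u) : H s p = some (X.announce u s) := by
  rw [hH s hs p, hu]; rfl

/-- The ancestor of the parent at distance `s` is the ancestor of `v` at distance `s + 1`. -/
theorem Heard.ancCode (hH : X.Heard v H t) {s : ℕ} (hs : s ≤ t) :
    (X.input v).ancCode H s = X.ancId v s := by
  cases s with
  | zero => simp [VertexInput.ancCode, ancId, input]
  | succ s =>
    simp only [VertexInput.ancCode]
    by_cases hv : v = X.root
    · subst hv
      rw [hH s (by omega), getElem?_parentPort_root]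
      have : X.parentTree.dep X.root = 0 := X.parentTree.dep_root
      simp [ancId, this]
    · rw [hH.eq_some (by omega) (nbrs_parentPort hv)]
      have := X.parentTree.dep_eq v hv
      simp only [Option.map_some, Option.getD_some, announce_div, ancId, this,
        Function.iterate_succ_apply]
      simp

theorem Heard.low (hH : X.Heard v H t) {s : ℕ} (hs : s ≤ t) :
    (X.input v).Low H s ↔ X.LowAt v s := by
  have hchild : (∀ p, ¬ (X.input v).IsChildPort p) ↔ ∀ c, ¬ X.IsParent v c := by
    constructor
    · intro h c hc
      obtain ⟨p, hp⟩ := exists_port (X.tree_le hc.1.symm)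
      exact h p ((isChildPort_iff hp).2 hc)
    · rintro h p hp
      obtain ⟨u, hu⟩ := exists_nbr_of_port hp.choose_spec.1
      exact h u ((isChildPort_iff hu).1 hp)
  cases s with
  | zero =>
    rw [lowAt_zero_iff, ← hchild]
    refine forall_congr' fun p => imp_congr_right fun _ => ?_
    simp
  | succ s =>
    rw [lowAt_succ_iff]
    constructor
    · intro h c hc
      obtain ⟨p, hp⟩ := exists_port (X.tree_le hc.1.symm)
      obtain ⟨s', m, h1, h2, h3⟩ := h p ((isChildPort_iff hp).2 hc)
      obtain rfl : s = s' := by omega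
      rw [hH.eq_some (by omega) hp] at h2
      obtain rfl := Option.some.inj h2
      exact (X.announce_mod c s).1 h3
    · intro h p hp
      obtain ⟨u, hu⟩ := exists_nbr_of_port hp.choose_spec.1
      exact ⟨s, _, rfl, hH.eq_some (by omega) hu,
        (X.announce_mod u s).2 (h u ((isChildPort_iff hu).1 hp))⟩

theorem lowAt_root_iff {s : ℕ} : X.LowAt X.root s ↔ X.height ≤ s := by
  have h0 : X.parentTree.dep X.root = 0 := X.parentTree.dep_root
  constructor
  · intro h
    obtain ⟨v, hv⟩ := X.exists_dep_eq_height
    have := h v (X.parentTree.root_anc v)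
    omega
  · intro h x _
    have := X.dep_le_height x
    omega

/-- The low bits rise to the root, which knows the height after that many rounds; the news then
descends one level per round. -/
theorem Heard.informed (hH : X.Heard v H t) {s : ℕ} (hs : s ≤ t) :
    (X.input v).Informed H s ↔ X.height + X.parentTree.dep v ≤ s := by
  unfold Informed
  split_ifs with h
  · obtain rfl := isRoot_iff.1 h
    have h0 : X.parentTree.dep X.root = 0 := X.parentTree.dep_root
    rw [hH.low hs, lowAt_root_iff, h0, add_zero]
  · rw [isRoot_iff] at h
    have hd := X.parentTree.dep_eq v h
    constructor
    · rintro ⟨s', m, rfl, h2, h3⟩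
      rw [hH.eq_some (by omega) (nbrs_parentPort h)] at h2
      obtain rfl := Option.some.inj h2
      have := (X.announce_div_mod _ s').1 h3
      omega
    · intro h1
      obtain ⟨s, rfl⟩ : ∃ r, s = r + 1 := ⟨s - 1, by omega⟩
      exact ⟨s, _, rfl, hH.eq_some (by omega) (nbrs_parentPort h),
        (X.announce_div_mod _ s).2 (by omega)⟩

theorem Heard.firstMessage (hH : X.Heard v H t) :
    (X.input v).firstMessage H t = X.announce v t := by
  unfold VertexInput.firstMessage announce
  simp only [hH.ancCode le_rfl, hH.informed le_rfl, hH.low le_rfl]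

theorem Heard.ancCode_eq_zero (hH : X.Heard v H t) (ht : X.parentTree.dep v + 1 ≤ t) :
    (X.input v).ancCode H (X.parentTree.dep v + 1) = 0 := by
  rw [hH.ancCode ht, ancId, if_neg (by omega)]

theorem Heard.depth (hH : X.Heard v H t) (ht : X.parentTree.dep v + 1 ≤ t) :
    (X.input v).depth H = X.parentTree.dep v := by
  refine le_antisymm (Nat.sInf_le (hH.ancCode_eq_zero ht)) ?_
  refine le_csInf ⟨_, hH.ancCode_eq_zero ht⟩ fun s hs => ?_
  by_contra hlt
  have hs : (X.input v).ancCode H (s + 1) = 0 := hs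
  rw [hH.ancCode (by omega), ancId, if_pos (by omega)] at hs
  omega

theorem Heard.height (hH : X.Heard v H t) (ht : 2 * X.height ≤ t) (h0 : 0 < X.height) :
    (X.input v).height H = X.height := by
  have hd := X.dep_le_height v
  have h1 : sInf {s | (X.input v).Informed H s} = X.height + X.parentTree.dep v := by
    have hmem : X.height + X.parentTree.dep v ∈ {s | (X.input v).Informed H s} :=
      (hH.informed (by omega)).2 le_rfl
    refine le_antisymm (Nat.sInf_le hmem) (le_csInf ⟨_, hmem⟩ fun s hs => ?_)
    by_contra hlt
    exact hlt ((hH.informed (by omega)).1 hs)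
  rw [VertexInput.height, h1, hH.depth (by omega)]
  omega

/-- Only an upper bound on the computed depth is needed: underestimating it overestimates the height
and delays the end of the phase. -/
theorem Heard.not_ready (hH : X.Heard v H t) (ht : t < 2 * X.height) :
    ¬ (X.input v).Ready H t := by
  rintro ⟨s, hs, h1, h2⟩
  have h3 := (hH.informed hs).1 h1
  have hd : (X.input v).depth H ≤ X.parentTree.dep v := by
    have := X.dep_le_height v
    exact Nat.sInf_le (hH.ancCode_eq_zero (by omega))
  omega

theorem Heard.ready (hH : X.Heard v H (2 * X.height)) (ht : 2 * X.height ≤ t)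
    (h0 : 0 < X.height) : (X.input v).Ready H t := by
  have hd := X.dep_le_height v
  refine ⟨X.height + X.parentTree.dep v, by omega, (hH.informed (by omega)).2 le_rfl, ?_⟩
  rw [hH.depth (by omega)]
  omega

end FirstPhase

end Congest.TAPInstance

/-! ### The execution computes the dynamic program. -/

namespace Congest.TAPInstance

open Classical ParentTree VertexInput

variable {V : Type} [DecidableEq V] (X : TAPInstance V)

/-- What `v` has received after `t` rounds of the algorithm. -/
noncomputable abbrev after (t : ℕ) (v : V) : History :=
  hist VertexInput.message X.toNetwork X.input t v

/-- What `v` receives in the algorithm. -/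
noncomputable abbrev received (v : V) : History :=
  fullHist VertexInput.message X.toNetwork X.input v

theorem after_eq {s t : ℕ} (h : s < t) (v : V) : X.after t v s = X.received v s :=
  hist_eq_fullHist _ _ _ h v

variable {X}

theorem received_eq {v u : V} {t p : ℕ} (hp : (X.nbrs v)[p]? = some u) :
    X.received v t p = (X.input u).message (X.after t u) t ((X.nbrs u).idxOf v) := by
  simp [received, fullHist, hp]

variable [Fintype V]

theorem message_of_heard {v : V} {t p : ℕ} (hH : X.Heard v (X.after t v) t)
    (ht : t < 2 * X.height) :
    (X.input v).message (X.after t v) t p = some (X.announce v t) := by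
  unfold VertexInput.message
  simp only
  rw [if_neg (hH.not_ready ht), hH.firstMessage]

/-- By induction on time: the message of a round depends only on what its sender heard before. -/
theorem heard_after {t : ℕ} (ht : t ≤ 2 * X.height) (v : V) : X.Heard v (X.after t v) t := by
  induction t using Nat.strong_induction_on generalizing v with
  | _ t ih =>
    intro s hs p
    rw [X.after_eq hs]
    cases hp : (X.nbrs v)[p]? with
    | none => simp [received, fullHist, hp]
    | some u =>
      rw [received_eq hp, message_of_heard (ih s hs (by omega) u) (by omega)]
      rfl

theorem heard_after' {t : ℕ} (ht : 2 * X.height ≤ t) (v : V) :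
    X.Heard v (X.after t v) (2 * X.height) := fun s hs p => by
  rw [X.after_eq (by omega), ← X.after_eq hs]
  exact heard_after le_rfl v s hs p

theorem heard_received (v : V) : X.Heard v (X.received v) (2 * X.height) := fun s hs p => by
  rw [← X.after_eq hs]
  exact heard_after le_rfl v s hs p

variable (X)

/-- The table of the dynamic program, as computed by the algorithm. -/
noncomputable def value (v : V) (k : ℕ) : ℕ∞ :=
  (X.input v).minValue (X.received v) (X.parentTree.dep v) X.height k

noncomputable def sourcePort (v : V) (k : ℕ) : ℕ :=
  (X.input v).minPort (X.received v) (X.parentTree.dep v) X.height k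

/-- The neighbor through which the table entry is attained. -/
noncomputable def source (v : V) (k : ℕ) : V := (X.nbrs v)[X.sourcePort v k]?.getD v

noncomputable def reachOf (v : V) : ℕ :=
  (X.input v).reach (X.received v) (X.parentTree.dep v) X.height

/-- The port at which `v` looks for a chosen link. -/
noncomputable def chosenPort (v : V) : ℕ := X.sourcePort v (X.reachOf v)

variable {X} (h0 : 0 < X.height)

section Messages

variable {v u : V} {t p : ℕ}

theorem chooses_after_iff (h1 : 5 * X.height ≤ t) :
    (X.input v).Chooses (X.after t v) (X.parentTree.dep v) X.height p ↔
      0 < X.parentTree.dep v ∧ (X.input v).IsLinkPort p ∧ p = X.chosenPort v :=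
  chooses_congr (fun _ hs => X.after_eq hs v) h1 (X.dep_le_height v) p

theorem portValue_parent (hp : (X.nbrs v)[p]? = some u) (hu : X.IsParent u v) {k : ℕ} :
    (X.input v).portValue (X.received v) (X.parentTree.dep v) X.height k p = ⊤ := by
  unfold portValue
  rw [input_ports hp]
  simp [hu, hu.1]

include h0

theorem depth_after (ht : 2 * X.height ≤ t) :
    (X.input v).depth (X.after t v) = X.parentTree.dep v :=
  (heard_after' ht v).depth (by have := X.dep_le_height v; omega)

theorem height_after (ht : 2 * X.height ≤ t) : (X.input v).height (X.after t v) = X.height :=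
  (heard_after' ht v).height le_rfl h0

theorem second_message (h1 : 2 * X.height ≤ t) (h2 : t < 4 * X.height) :
    (X.input v).message (X.after t v) t p =
      (X.input v).secondMessage (X.received v) (X.parentTree.dep v) X.height t := by
  unfold VertexInput.message
  simp only
  rw [if_pos ((heard_after' h1 v).ready h1 h0), depth_after h0 h1, height_after h0 h1, if_pos h2]
  exact secondMessage_congr (fun s hs => X.after_eq hs v) h1 (X.dep_le_height v)

theorem third_message (h1 : 4 * X.height ≤ t) (h2 : t < 5 * X.height) :
    (X.input v).message (X.after t v) t p =
      if t = 4 * X.height + X.parentTree.dep v ∧ 0 < X.parentTree.dep v ∧ p = X.chosenPort v then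
        some (X.reachOf v) else none := by
  have h3 : 2 * X.height ≤ t := by omega
  unfold VertexInput.message
  simp only
  rw [if_pos ((heard_after' h3 v).ready h3 h0), depth_after h0 h3, height_after h0 h3,
    if_neg (by omega), if_pos h2]
  exact thirdMessage_congr (fun s hs => X.after_eq hs v) (X.dep_le_height v) p

theorem fourth_message (h1 : 5 * X.height ≤ t) :
    (X.input v).message (X.after t v) t p =
      if 0 < X.parentTree.dep v ∧ (X.input v).IsLinkPort p ∧ p = X.chosenPort v then
        some 1 else none := by
  have h3 : 2 * X.height ≤ t := by omega
  unfold VertexInput.message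
  simp only
  rw [if_pos ((heard_after' h3 v).ready h3 h0), depth_after h0 h3, height_after h0 h3,
    if_neg (by omega), if_neg (by omega)]
  simp only [chooses_after_iff h1]

theorem portValue_child (hp : (X.nbrs v)[p]? = some u) (hu : X.IsParent v u) {k : ℕ}
    (h1 : 1 ≤ k) (h2 : k ≤ X.parentTree.dep v) :
    (X.input v).portValue (X.received v) (X.parentTree.dep v) X.height k p =
      X.value u k - X.value u (X.parentTree.dep u) := by
  have hd := X.parentTree.dep_eq u (X.isParent_iff.1 hu).1
  have h3 := X.dep_le_height u
  rw [(X.isParent_iff.1 hu).2] at hd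
  have hnp : ¬ X.IsParent u v := fun h => by
    have := h.2
    have := hu.2
    omega
  unfold portValue
  rw [input_ports hp]
  simp only [hu.1.symm, hnp, decide_true, decide_false, if_true, Bool.false_eq_true, if_false]
  rw [received_eq hp, second_message h0 (by omega) (by omega), secondMessage]
  rw [if_pos (by omega), decodeENat_encodeENat,
    show 4 * X.height - X.parentTree.dep u - (4 * X.height - (X.parentTree.dep v + 1) - k) = k by
      omega]
  rfl

theorem ancCode_received {k : ℕ} (h1 : k ≤ X.parentTree.dep v) :
    (X.input v).ancCode (X.received v) (X.parentTree.dep v - k) =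
      X.ident (X.parentTree.up v k) + 1 := by
  have h3 := X.dep_le_height v
  rw [(heard_received v).ancCode (by omega), ancId, if_pos (by omega)]
  rfl

/-- Every ancestor of `u` is announced within `2h` rounds, and identifiers are distinct, so
comparing codes decides ancestry. -/
theorem portValue_link (hp : (X.nbrs v)[p]? = some u) (hu : X.Link v u) {k : ℕ}
    (h2 : k ≤ X.parentTree.dep v) :
    (X.input v).portValue (X.received v) (X.parentTree.dep v) X.height k p =
      if X.parentTree.Anc (X.parentTree.up v k) u then ⊤ else (X.weight s(v, u) : ℕ∞) := by
  have hd := X.dep_le_height u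
  unfold portValue
  rw [input_ports hp]
  simp only [hu.2, decide_false, Bool.false_eq_true, if_false]
  refine if_congr ?_ rfl rfl
  rw [ancCode_received h0 h2]
  constructor
  · rintro ⟨s, hs, m, h3, h4⟩
    rw [(heard_received v).eq_some hs hp] at h3
    obtain rfl := Option.some.inj h3
    rw [announce_div, ancId] at h4
    split_ifs at h4
    exact ⟨s, X.ident_injective (Nat.succ_injective h4)⟩
  · rintro h3
    have h4 := h3.dep_le
    refine ⟨X.parentTree.dep u - X.parentTree.dep (X.parentTree.up v k), by omega, _,
      (heard_received v).eq_some (by omega) hp, ?_⟩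
    rw [announce_div, ancId, if_pos (by omega)]
    exact congrArg (fun x => X.ident x + 1) h3.eq_up

end Messages

theorem value_le {v u : V} {p k : ℕ} (hp : (X.nbrs v)[p]? = some u) : X.value v k ≤
    (X.input v).portValue (X.received v) (X.parentTree.dep v) X.height k p :=
  Finset.inf_le (Finset.mem_range.2 (port_lt hp))

theorem source_spec {v : V} (hv : v ≠ X.root) (k : ℕ) :
    (X.nbrs v)[X.sourcePort v k]? = some (X.source v k) ∧
    (X.input v).portValue (X.received v) (X.parentTree.dep v) X.height k (X.sourcePort v k) =
      X.value v k := by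
  obtain ⟨p, hp, hp'⟩ := Finset.exists_mem_eq_inf (Finset.range (X.input v).ports.length)
    ⟨_, Finset.mem_range.2 (port_lt (nbrs_parentPort hv))⟩
    ((X.input v).portValue (X.received v) (X.parentTree.dep v) X.height k)
  have h1 : X.sourcePort v k < (X.input v).ports.length ∧
      (X.input v).portValue (X.received v) (X.parentTree.dep v) X.height k (X.sourcePort v k) =
        X.value v k :=
    Nat.sInf_mem (s := {p | p < (X.input v).ports.length ∧
      (X.input v).portValue (X.received v) (X.parentTree.dep v) X.height k p = X.value v k})
      ⟨p, Finset.mem_range.1 hp, hp'.symm⟩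
  refine ⟨?_, h1.2⟩
  obtain ⟨u, hu⟩ := exists_nbr h1.1
  rw [source, hu]
  rfl

include h0 in
-- The parent speaks to `v` in the expected round exactly if its chain continues through `v`.
-- Silence yields the default value, the depth of `v`, and so opens a new chain.
theorem reachOf_eq {v : V} (hv : v ≠ X.root) :
    (X.parentTree.par v ≠ X.root ∧ X.source (X.parentTree.par v)
      (X.reachOf (X.parentTree.par v)) = v ∧ X.reachOf v = X.reachOf (X.parentTree.par v)) ∨
    (¬ (X.parentTree.par v ≠ X.root ∧ X.source (X.parentTree.par v)
      (X.reachOf (X.parentTree.par v)) = v) ∧ X.reachOf v = X.parentTree.dep v) := by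
  set u := X.parentTree.par v with hu
  have hd := X.parentTree.dep_eq v hv
  have hh := X.dep_le_height v
  have hadj := X.tree_le (X.isParent_par hv).1
  have h1 : X.reachOf v = (if X.parentTree.dep u ≠ 0 ∧ (X.nbrs u).idxOf v = X.chosenPort u then
      some (X.reachOf u) else none).getD (X.parentTree.dep v) := by
    rw [reachOf, reach, received_eq (nbrs_parentPort hv), third_message h0 (by omega) (by omega)]
    congr 1
    refine if_congr ?_ rfl rfl
    rw [← hu] at hd ⊢
    refine ⟨fun h => ⟨by omega, h.2.2⟩, fun h => ⟨by omega, by omega, h.2⟩⟩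
  have h2 : (X.parentTree.dep u ≠ 0 ∧ (X.nbrs u).idxOf v = X.chosenPort u) ↔
      (u ≠ X.root ∧ X.source u (X.reachOf u) = v) := by
    rw [show u ≠ X.root ↔ X.parentTree.dep u ≠ 0 from
      (X.parentTree.eq_root_iff (v := u)).not]
    refine and_congr_right fun h => ?_
    have h3 := (source_spec (X := X) (v := u)
      (fun h' => h (X.parentTree.eq_root_iff.1 h')) (X.reachOf u)).1
    have h4 := port_idxOf hadj.symm
    constructor
    · intro h5
      rw [h5, chosenPort, h3] at h4
      exact Option.some.inj h4
    · intro h5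
      rw [h5] at h3
      exact port_unique h4 h3
  by_cases h3 : u ≠ X.root ∧ X.source u (X.reachOf u) = v
  · exact Or.inl ⟨h3.1, h3.2, by rw [h1, if_pos (h2.2 h3)]; rfl⟩
  · exact Or.inr ⟨h3, by rw [h1, if_neg fun h => h3 (h2.1 h)]; rfl⟩

/-- The solution of the dynamic program found by the algorithm. -/
noncomputable def table : CoverTable X.parentTree X.Link fun v u => X.weight s(v, u) where
  M := X.value
  src := X.source
  kk := X.reachOf
  le_own {v u k} _ h2 h3 h4 := by
    obtain ⟨p, hp⟩ := exists_port h3.1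
    refine (value_le hp).trans_eq ?_
    rw [portValue_link h0 hp h3 h2, if_neg h4]
  le_child {c k} h1 h2 h3 := by
    obtain ⟨p, hp⟩ := exists_port (X.tree_le (X.isParent_par h1).1.symm)
    refine (value_le hp).trans_eq ?_
    rw [portValue_child h0 hp (X.isParent_par h1) h2 h3]
  attained {v k} h1 h2 h3 := by
    have hv : v ≠ X.root := by
      rintro rfl
      have : X.parentTree.dep X.root = 0 := X.parentTree.dep_root
      omega
    obtain ⟨h4, h5⟩ := source_spec hv k
    by_cases h6 : X.Link v (X.source v k)
    · rw [portValue_link h0 h4 h6 h2] at h5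
      split_ifs at h5 with h7
      · exact absurd h5.symm h3
      · exact Or.inl ⟨h6, h7, h5.symm⟩
    · have h7 : X.tree.Adj v (X.source v k) := by
        by_contra h7
        exact h6 ⟨adj_of_port h4, h7⟩
      rcases X.tree_adj_iff.1 h7 with h8 | h8
      · rw [portValue_parent h4 h8] at h5
        exact absurd h5.symm h3
      · rw [portValue_child h0 h4 h8 h1 h2] at h5
        obtain ⟨h9, h10⟩ := X.isParent_iff.1 h8
        exact Or.inr ⟨h9, h10, h6, h5.symm⟩
  kk_eq hv := reachOf_eq h0 hv

end Congest.TAPInstance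

/-! ### Outputs, message sizes and the theorem. -/

namespace Congest.TAPInstance

open Classical ParentTree VertexInput

variable {V : Type} [DecidableEq V] [Fintype V] {X : TAPInstance V} (h0 : 0 < X.height)

/-- The ports chosen by `v`. -/
noncomputable def outputOf (X : TAPInstance V) (v : V) : Finset ℕ :=
  (Finset.range (X.input v).ports.length).filter fun p => (X.input v).IsLinkPort p ∧
    ((0 < X.parentTree.dep v ∧ (X.input v).IsLinkPort p ∧ p = X.chosenPort v) ∨
      (X.received v (5 * X.height) p).isSome)

include h0

theorem ports_ne_nil (v : V) : (X.input v).ports ≠ [] := by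
  have h1 : ∃ u, X.graph.Adj v u := by
    by_cases hv : v = X.root
    · obtain ⟨w, hw⟩ := X.exists_dep_eq_height
      have h2 : w ≠ X.root := by
        rintro rfl
        have : X.parentTree.dep X.root = 0 := X.parentTree.dep_root
        omega
      obtain ⟨c, hc, -⟩ := exists_isParent_of_anc (X.parentTree.root_anc w) h2
      rw [hv]
      exact ⟨c, X.tree_le hc.1.symm⟩
    · exact ⟨_, X.tree_le (X.isParent_par hv).1⟩
  obtain ⟨u, hu⟩ := h1
  obtain ⟨p, hp⟩ := exists_port hu
  intro h2
  have := port_lt hp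
  rw [h2] at this
  exact absurd this (Nat.not_lt_zero p)

theorem result_eq_none {t : ℕ} (ht : t < 5 * X.height + 1) (v : V) :
    (X.input v).result (X.after t v) t = none := by
  unfold VertexInput.result
  simp only
  rw [if_neg (ports_ne_nil h0 v), if_neg]
  rintro ⟨h1, h2⟩
  rcases lt_or_ge t (2 * X.height) with h3 | h3
  · exact (heard_after h3.le v).not_ready h3 h1
  · rw [height_after h0 h3] at h2
    omega

theorem result_eq_some (v : V) :
    (X.input v).result (X.after (5 * X.height + 1) v) (5 * X.height + 1) =
      some (X.outputOf v) := by
  have h3 : 2 * X.height ≤ 5 * X.height + 1 := by omega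
  unfold VertexInput.result
  simp only
  rw [if_neg (ports_ne_nil h0 v), depth_after h0 h3, height_after h0 h3,
    if_pos ⟨(heard_after' h3 v).ready h3 h0, le_rfl⟩, X.after_eq (by omega)]
  refine congrArg some (Finset.filter_congr fun p _ => and_congr_right fun _ => ?_)
  rw [chooses_after_iff (by omega)]

omit h0 in
theorem chosenPort_iff {v u : V} {p : ℕ} (hp : (X.nbrs v)[p]? = some u) :
    (0 < X.parentTree.dep v ∧ (X.input v).IsLinkPort p ∧ p = X.chosenPort v) ↔
      v ≠ X.root ∧ X.Link v u ∧ X.source v (X.reachOf v) = u := by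
  have h1 : 0 < X.parentTree.dep v ↔ v ≠ X.root := by
    rw [Nat.pos_iff_ne_zero]
    exact (X.parentTree.eq_root_iff (v := v)).not.symm
  rw [h1, isLinkPort_iff hp]
  refine and_congr_right fun hv => and_congr_right fun _ => ?_
  have h3 := (source_spec hv (X.reachOf v)).1
  constructor
  · intro h5
    rw [h5, chosenPort, h3] at hp
    exact Option.some.inj hp
  · intro h5
    rw [h5] at h3
    exact port_unique hp h3

theorem locallyDescribes_outputOf :
    X.LocallyDescribes X.outputOf (chosen (table h0)) := by
  intro v u p hp
  have hadj := adj_of_port hp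
  have h1 : (X.received v (5 * X.height) p).isSome ↔
      u ≠ X.root ∧ X.Link u v ∧ X.source u (X.reachOf u) = v := by
    rw [received_eq hp, fourth_message h0 le_rfl, ← chosenPort_iff (port_idxOf hadj.symm)]
    split_ifs with h
    · exact iff_of_true rfl h
    · exact iff_of_false (by simp) h
  have hsymm : X.Link u v ↔ X.Link v u := by
    simp only [Link, X.graph.adj_comm, X.tree.adj_comm]
  rw [outputOf, Finset.mem_filter, Finset.mem_range, chosenPort_iff hp, h1, isLinkPort_iff hp,
    mem_chosen]
  change _ ↔ ∃ x, (x ≠ X.root ∧ X.Link x (X.source x (X.reachOf x))) ∧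
    s(x, X.source x (X.reachOf x)) = s(v, u)
  constructor
  · rintro ⟨-, -, ⟨h2, h3, h4⟩ | ⟨h2, h3, h4⟩⟩
    · exact ⟨v, ⟨h2, by rwa [h4]⟩, by rw [h4]⟩
    · exact ⟨u, ⟨h2, by rwa [h4]⟩, by rw [h4, Sym2.eq_swap]⟩
  · rintro ⟨x, ⟨h2, h3⟩, h4⟩
    rcases Sym2.eq_iff.1 h4 with ⟨rfl, h5⟩ | ⟨rfl, h5⟩
    · rw [h5] at h3
      exact ⟨port_lt hp, h3, Or.inl ⟨h2, h3, h5⟩⟩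
    · rw [h5] at h3
      exact ⟨port_lt hp, hsymm.1 h3, Or.inr ⟨h2, h3, h5⟩⟩

/-- A first-phase message is at most `4 * (B + 1) + 3`, a reduced weight at most `B`, and a target
depth less than the number of vertices. -/
theorem message_le {B : ℕ} (hid : ∀ v, X.ident v ≤ B) (hw : ∀ e ∈ X.graph.edgeSet, X.weight e ≤ B)
    {t p m : ℕ} {v : V} (hm : (X.input v).message (X.after t v) t p = some m) :
    m ≤ max (4 * B + 7) (Fintype.card V) := by
  have h1 := X.dep_le_height v
  have h2 := X.height_lt_card
  rcases lt_or_ge t (2 * X.height) with h3 | h3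
  · rw [message_of_heard (heard_after h3.le v) h3] at hm
    obtain rfl := Option.some.inj hm
    refine le_max_of_le_left ?_
    have h4 : X.ancId v t ≤ B + 1 := by
      unfold ancId
      split_ifs
      · exact Nat.succ_le_succ (hid _)
      · omega
    unfold announce
    split_ifs <;> omega
  rcases lt_or_ge t (4 * X.height) with h4 | h4
  · rw [second_message h0 h3 h4] at hm
    unfold secondMessage encodeENat at hm
    simp only at hm
    split_ifs at hm with h5 h6
    obtain rfl := Option.some.inj hm
    set k := 4 * X.height - X.parentTree.dep v - t
    have hv : v ≠ X.root := by
      rintro rfl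
      have : X.parentTree.dep X.root = 0 := X.parentTree.dep_root
      omega
    have h7 : X.value v (X.parentTree.dep v) ≠ ⊤ := (table h0).ne_top link_crossing hv
    have h8 : X.value v k ≠ ⊤ := fun h8 => h6 (ENat.sub_eq_top_iff.2 ⟨h8, h7⟩)
    have h9 : X.value v k ≤ B := (table h0).M_le_of_weight_le
      (fun a b hab => hw s(a, b) hab.1) v h5.1 h5.2.le h8
    refine le_max_of_le_left (le_trans ?_ (show B ≤ 4 * B + 7 by omega))
    exact ENat.toNat_le_of_le_natCast (tsub_le_self.trans h9)
  rcases lt_or_ge t (5 * X.height) with h5 | h5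
  · rw [third_message h0 h4 h5] at hm
    split_ifs at hm with h6
    obtain rfl := Option.some.inj hm
    have hv : v ≠ X.root := by
      rintro rfl
      have : X.parentTree.dep X.root = 0 := X.parentTree.dep_root
      omega
    have h7 : X.reachOf v ≤ X.parentTree.dep v := ((table h0).kk_spec link_crossing v hv).2.1
    exact le_max_of_le_right (by omega)
  · rw [fourth_message h0 h5] at hm
    split_ifs at hm
    obtain rfl := Option.some.inj hm
    exact le_max_of_le_left (by omega)

omit h0 [DecidableEq V] in
theorem nbrs_eq_nil (hh : X.height = 0) (v : V) : X.nbrs v = [] := by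
  have hroot : ∀ u, u = X.root := fun u => by
    have := X.dep_le_height u
    exact X.parentTree.eq_root_iff.2 (by omega)
  refine List.eq_nil_iff_forall_not_mem.2 fun u hu => ?_
  exact ((X.mem_nbrs v u).1 hu).ne ((hroot v).trans (hroot u).symm)

end Congest.TAPInstance

/-- From `n < 2 ^ (2 * L)`, the power `n ^ c` costs `2 * c * L` bits, and the factor 16 that absorbs
`4` and `7` costs at most `4 * L` more. -/
theorem max_lt_two_pow {n c : ℕ} (hn : 2 ≤ n) :
    max (4 * n ^ c + 7) n < 2 ^ ((2 * c + 4) * Nat.log 2 n) := by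
  set L := Nat.log 2 n with hL
  have h1 : 1 ≤ L := Nat.log_pos (by norm_num) hn
  have h2 : n < 2 ^ (2 * L) :=
    (Nat.lt_pow_succ_log_self (by norm_num) n).trans_le
      (Nat.pow_le_pow_right (by norm_num) (by omega))
  have h3 : n ^ c ≤ 2 ^ (2 * L * c) := by
    rw [pow_mul]
    exact Nat.pow_le_pow_left h2.le c
  have h4 : 2 ^ (2 * L * c) * 16 ≤ 2 ^ ((2 * c + 4) * L) := by
    rw [show (16 : ℕ) = 2 ^ 4 by norm_num, ← pow_add]
    exact Nat.pow_le_pow_right (by norm_num) (by nlinarith)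
  have h5 : 2 ^ (2 * L) ≤ 2 ^ ((2 * c + 4) * L) :=
    Nat.pow_le_pow_right (by norm_num) (by nlinarith [Nat.zero_le (c * L)])
  have h6 : 1 ≤ 2 ^ (2 * L * c) := Nat.one_le_two_pow
  exact max_lt (by omega) (h2.trans_le h5)

open Congest TAPInstance in
theorem mainTheorem1 :
    ∃ (A : Congest.Algorithm Congest.VertexInput (Finset ℕ)) (K : ℕ),
      ∀ c : ℕ, ∃ C : ℕ,
        ∀ (V : Type) [Fintype V] [DecidableEq V] (X : Congest.TAPInstance V),
          (∀ v, X.ident v ≤ Fintype.card V ^ c) →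
          (∀ e ∈ X.graph.edgeSet, X.weight e ≤ Fintype.card V ^ c) →
          A.MessagesBoundedBy X.toNetwork X.input (C * Nat.log 2 (Fintype.card V)) ∧
          ∃ (out : V → Finset ℕ) (Aug : Finset (Sym2 V)),
            A.HaltsWithin X.toNetwork X.input (K * X.height) out ∧
            X.LocallyDescribes out Aug ∧
            X.IsAugmentation Aug ∧
            ∀ S : Finset (Sym2 V), X.IsAugmentation S → X.cost Aug ≤ 2 * X.cost S := by
  -- All vertices halt after `5h + 1` rounds, at most `6h` when `h` is positive; height `0` is
  -- treated separately.
  refine ⟨historyAlgorithm VertexInput.message VertexInput.result, 6, fun c => ⟨2 * c + 4, ?_⟩⟩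
  intro V _ _ X hid hw
  rcases Nat.eq_zero_or_pos X.height with hh | h0
  · have hnil := nbrs_eq_nil hh
    refine ⟨fun t v p m hp => ?_, fun _ => ∅, ∅, ?_, ?_, ?_, ?_⟩
    · rw [hnil] at hp
      exact absurd hp (Nat.not_lt_zero p)
    · refine historyAlgorithm_haltsWithin (T := 0) (fun t ht => absurd ht (Nat.not_lt_zero t))
        (fun v => ?_) (Nat.zero_le _)
      exact if_pos (by simp [TAPInstance.input, hnil])
    · intro v u p hp
      rw [hnil] at hp
      simp at hp
    · refine X.isAugmentation_of_crossing (by simp) fun v hv => absurd ?_ hv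
      have := X.dep_le_height v
      exact X.parentTree.eq_root_iff.2 (by omega)
    · intro S _
      simp [TAPInstance.cost]
  · have hT : ∀ t < 5 * X.height + 1, ∀ v,
        (X.input v).result (X.after t v) t = none := fun t ht v => result_eq_none h0 ht v
    refine ⟨historyAlgorithm_messagesBoundedBy hT (result_eq_some h0) fun t _ v p _ m hm => ?_,
      X.outputOf, chosen (table h0),
      historyAlgorithm_haltsWithin hT (result_eq_some h0) (by omega),
      locallyDescribes_outputOf h0, isAugmentation_chosen _, fun S hS => cost_chosen_le _ hS⟩
    have h2 := X.height_lt_card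
    exact (message_le h0 hid hw hm).trans_lt (max_lt_two_pow (by omega))
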